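/- Let $\mathcal S$ be a standard Borel (Polish) space, $\mathbf S=(\mathbf S_t)_{t\ge 0}$ a time-homogeneous Markov chain on $\mathcal S$ with transition kernel $P$, $R:\mathcal S\to\mathbb R$ measurable, $\gamma\in(0,1)$, $R_\ell<R_u$ real numbers, $N,K\ge 1$ integers, $n(\mathbf i,k)\ge 1$ integers (for $\mathbf i$ a finite sequence of positive integers and $k\ge 1$), and $\mathbf s\in\mathcal S$. Put $[N]=\{1,\dots,N\}$, let $\sigma=\min(N,\inf\{t\ge 1: R(\mathbf S_t)\notin[R_\ell,R_u]\})$, and for $t\in[N]$, $\nu\in\mathbb R$ let $$Z_t(\nu)=\frac{1-\gamma}{2(R_u-R_\ell)(1-\gamma^N)}\sum_{u=0}^{\min(t,\sigma)-1}\gamma^u\,(\nu-R(\mathbf S_u)).$$ *The estimator.* For a path $\mathbf S^{\mathbf i}$ let $Z^{(1)}_{\mathbf i,t}(\nu)$ be $Z_t(\nu)$ evaluated along $\mathbf S^{\mathbf i}$, and recursively $$Z^{(k+1)}_{\mathbf i,t}(\nu)=Z^{(k)}_{[\mathbf i,1],t}(\nu)-\frac1{n(\mathbf i,k)}\sum_{j=2}^{n(\mathbf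 i,k)+1}\min_{u\in[N]}Z^{(k)}_{[\mathbf i,j],u}(\nu)\Big|_{t},$$ where $\mathbf S^{[\mathbf i,1]}=\mathbf S^{\mathbf i}$ and where, for each $t$ and each $j\ge2$, "$|_t$" means that $\mathbf S^{[\mathbf i,j]}$ is a freshly simulated path which follows the law of the chain conditioned on coinciding with $\mathbf S^{\mathbf i}$ up to and including time $t$, all these simulations being conditionally independent. With paths $\mathbf S^{[k,j]}$ ($1\le k\le K$, $1\le j\le n(K,K)$) that are independent copies of the chain started in $\mathbf s$, and independent further simulations, define $$V_{\mathbf s}(\nu)=\max\Big(-\tfrac12,\min\Big(\tfrac12,\frac1{n(K,K)}\sum_{j=1}^{n(K,K)}\sum_{k=1}^K\min_{u\in[N]}Z^{(k)}_{[k,j],u}(\nu)\Big)\Big),\qquad \tilde f_{\mathbf s}(\nu)=\mathbb E[V_{\mathbf s}(\nu)].$$ *The iterates.* Let $V_{\mathbf s,0},V_{\mathbf s,1},\dots$ be independent versions of the random function $V_{\mathbf s}$, let $(\alpha_m)_{m\ge0}$ be a (possibly random) almost surely non-negative predictable sequence of step sizes (there is a filtration $(\mathcal F_m)_{m\ge0}$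 such that $\alpha_m$ is $\mathcal F_m$-measurable, the samples used in $V_{\mathbf s,m}$ are $\mathcal F_{m+1}$-measurable and independent of $\mathcal F_m$), let $\nu_0(\mathbf s)\in[R_\ell,R_u]$, and $$\nu_{m+1}(\mathbf s)=\nu_m(\mathbf s)-\alpha_m V_{\mathbf s,m}(\nu_m(\mathbf s)),\qquad m\ge 0.$$ **Theorem.** Suppose that almost surely $\sum_{m=1}^\infty\alpha_m=\infty$ and $\sum_{m=1}^\infty\alpha_m^2<\infty$. Then, almost surely, there is a (possibly sample path dependent) nonempty compact connected internally chain transitive invariant set $E\subset\mathbb R$ of the ODE $$\frac{d}{dx}\nu(x)=-\tilde f_{\mathbf s}(\nu(x))$$ such that $(\nu_m(\mathbf s))_m$ converges to $E$, that is, $\operatorname{dist}(\nu_m(\mathbf s),E)\to0$ as $m\to\infty$. Here a closed set $E\subset\mathbb R$ is an internally chain transitive invariant set of the ODE if (i) every trajectory $\nu:\mathbb R\to\mathbb R$ of the ODE with $\nu(0)\in E$ satisfies $\nu(x)\in E$ for all $x\in\mathbb R$, and (ii) for all $a,b\in E$ and $\epsilon,T>0$ there are $l\ge1$ and points $p_0=a,p_1,\dots,p_l=b$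 in $E$ such that for each $0\le i<l$ the trajectory of the ODE started at $p_i$ enters the $\epsilon$-neighbourhood of $p_{i+1}$ at some time $\ge T$. -/

import Mathlib

open MeasureTheory ProbabilityTheory Filter Topology

namespace SBGIA

universe u

section Chain

variable {S : Type u} [MeasurableSpace S] (P : Kernel S S) [IsMarkovKernel P]

/-- The time-homogeneous transition mechanism with kernel `P`, as a family of kernels from
histories `x₀, …, xₜ` to the next state. -/
noncomputable def step (t : ℕ) : Kernel ((_ : Finset.Iic t) → S) S :=
  P.comap (fun h => h ⟨t, Finset.mem_Iic.2 le_rfl⟩) (measurable_pi_apply _)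

instance (t : ℕ) : IsMarkovKernel (step P t) := by
  unfold step; infer_instance

/-- The law of the Markov chain `(Sₜ)` with transition kernel `P` started in `s`. -/
noncomputable def pathLaw (s : S) : Measure (ℕ → S) :=
  Kernel.traj (X := fun _ => S) (step P) 0 (fun _ => s)

/-- The regular conditional law of the Markov chain given that its path up to and including
time `t` coincides with the path of `x` up to and including time `t`. -/
noncomputable def resampleLaw (t : ℕ) (x : ℕ → S) : Measure (ℕ → S) :=
  Kernel.traj (X := fun _ => S) (step P) t (Preorder.frestrictLe t x)

end Chain

section Samples

/-- The random data, besides the path `S^i` itself, from which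
`Z^{(k+1)}_{i,1}, …, Z^{(k+1)}_{i,N}` are computed.  For `k = 0` there is none.  For the step from
level `k + 1` to level `k + 2` at the index `i` one needs the data of `Z^{(k+1)}_{[i,1]}`
(which uses the same path, `S^{[i,1]} = S^i`), and, for every time `t ∈ {1, …, N}` (encoded as
`t : Fin N`, standing for the time `t + 1`) and every `j ∈ {2, …, n(i,k+1) + 1}` (encoded as
`j : Fin (n i (k + 1))`, standing for `j + 2`), a path `S^{[i,j]}` conditioned to agree with `S^i`
up to that time, together with the data of `Z^{(k+1)}_{[i,j]}` along this path. -/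
def NestedSample (S : Type u) (N : ℕ) (n : List ℕ → ℕ → ℕ) : ℕ → List ℕ → Type u
  | 0, _ => PUnit
  | k + 1, i => NestedSample S N n k (i ++ [1]) ×
      ((_t : Fin N) → (j : Fin (n i (k + 1))) → (ℕ → S) × NestedSample S N n k (i ++ [j.1 + 2]))

instance instMeasurableSpaceNestedSample (S : Type u) [MeasurableSpace S] (N : ℕ)
    (n : List ℕ → ℕ → ℕ) : (k : ℕ) → (i : List ℕ) → MeasurableSpace (NestedSample S N n k i)
  | 0, _ => (inferInstance : MeasurableSpace PUnit)
  | k + 1, i =>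
    haveI := instMeasurableSpaceNestedSample S N n k
    (inferInstance : MeasurableSpace (NestedSample S N n k (i ++ [1]) ×
      ((_t : Fin N) → (j : Fin (n i (k + 1))) → (ℕ → S) × NestedSample S N n k (i ++ [j.1 + 2]))))

variable {S : Type u} [MeasurableSpace S] (P : Kernel S S) [IsMarkovKernel P]

/-- The law of the data `NestedSample S N n k i`, given that the path `S^i` equals `x`.
All the resampled paths are drawn independently of each other. -/
noncomputable def nestedLaw (N : ℕ) (n : List ℕ → ℕ → ℕ) :
    (k : ℕ) → (i : List ℕ) → (ℕ → S) → Measure (NestedSample S N n k i)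
  | 0, _, _ => (Measure.dirac PUnit.unit : Measure PUnit)
  | k + 1, i, x => (nestedLaw N n k (i ++ [1]) x).prod
      (Measure.pi fun t : Fin N => Measure.pi fun j : Fin (n i (k + 1)) =>
        (resampleLaw P (t.1 + 1) x).bind fun y =>
          (nestedLaw N n k (i ++ [j.1 + 2]) y).map (Prod.mk y))

/-- The random data from which one evaluation of the estimator `V_s` is computed: for every
`j ∈ {1, …, n(K,K)}` and every level `k ∈ {1, …, K}` (encoded as `j : Fin (n [K] K)` and
`k : Fin K`, standing for `j + 1` and `k + 1`), the path `S^{[k,j]}` and the data for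
`Z^{(k)}_{[k,j]}`. -/
abbrev EstimatorSample (S : Type u) (N K : ℕ) (n : List ℕ → ℕ → ℕ) : Type u :=
  (j : Fin (n [K] K)) → (k : Fin K) → (ℕ → S) × NestedSample S N n k.1 [k.1 + 1, j.1 + 1]

/-- The law of this data when all the paths start in `s`. -/
noncomputable def estimatorLaw (N K : ℕ) (n : List ℕ → ℕ → ℕ) (s : S) :
    Measure (EstimatorSample S N K n) :=
  Measure.pi fun j : Fin (n [K] K) => Measure.pi fun k : Fin K =>
    (pathLaw P s).bind fun x => (nestedLaw P N n k.1 [k.1 + 1, j.1 + 1] x).map (Prod.mk x)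

end Samples

section WellDefined

/-! The laws above depend measurably on the path and are probability measures, so that the
mixtures in their definition are genuine ones. -/

theorem measurable_measurePi {A ι : Type*} [MeasurableSpace A] [Fintype ι] {B : ι → Type*}
    [∀ i, MeasurableSpace (B i)] (κ : ∀ i, A → Measure (B i)) (hκ : ∀ i, Measurable (κ i))
    [∀ i a, IsProbabilityMeasure (κ i a)] :
    Measurable fun a => Measure.pi fun i => κ i a := by
  refine Measurable.measure_of_isPiSystem_of_isProbabilityMeasure generateFrom_pi.symm
    isPiSystem_pi ?_
  rintro _ ⟨t, ht, rfl⟩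
  simp only [Measure.pi_pi]
  exact Finset.measurable_prod _ fun i _ =>
    (Measure.measurable_coe (ht i (Set.mem_univ i))).comp (hκ i)

variable {S : Type u} [MeasurableSpace S] (P : Kernel S S) [IsMarkovKernel P]

theorem measurable_resampleLaw (t : ℕ) : Measurable (resampleLaw P t) :=
  (Kernel.measurable _).comp (Preorder.measurable_frestrictLe t)

instance (t : ℕ) (x : ℕ → S) : IsProbabilityMeasure (resampleLaw P t x) := by
  unfold resampleLaw; infer_instance

instance (s : S) : IsProbabilityMeasure (pathLaw P s) := by
  unfold pathLaw; infer_instance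

theorem measurable_map_prodMk {A B : Type*} [MeasurableSpace A] [MeasurableSpace B]
    {κ : A → Measure B} (hκ : Measurable κ) (hp : ∀ a, IsProbabilityMeasure (κ a)) :
    Measurable fun a => (κ a).map (Prod.mk a) := by
  let K : Kernel A B := ⟨κ, hκ⟩
  have : IsMarkovKernel K := ⟨hp⟩
  convert (Kernel.id ×ₖ K).measurable using 2 with a
  rw [Kernel.prod_apply, Kernel.id_apply, Measure.dirac_prod]
  rfl

theorem isProbabilityMeasure_bind {A B : Type*} [MeasurableSpace A] [MeasurableSpace B]
    (m : Measure A) [IsProbabilityMeasure m]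
    {κ : A → Measure B} (hκ : Measurable κ) (hp : ∀ a, IsProbabilityMeasure (κ a)) :
    IsProbabilityMeasure (m.bind κ) := by
  constructor
  rw [Measure.bind_apply .univ hκ.aemeasurable]
  simp

theorem nestedLaw_aux (N : ℕ) (n : List ℕ → ℕ → ℕ) : ∀ (k : ℕ) (i : List ℕ),
    Measurable (nestedLaw P N n k i) ∧ ∀ x, IsProbabilityMeasure (nestedLaw P N n k i x)
  | 0, _ => ⟨measurable_const, fun _ => Measure.dirac.isProbabilityMeasure⟩
  | k + 1, i => by
    have ih := nestedLaw_aux N n k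
    have h1 : ∀ (i : List ℕ), Measurable fun y => (nestedLaw P N n k i y).map (Prod.mk y) :=
      fun i => measurable_map_prodMk (ih i).1 (ih i).2
    have h2 : ∀ (i : List ℕ) y, IsProbabilityMeasure ((nestedLaw P N n k i y).map (Prod.mk y)) :=
      fun i y => have := (ih i).2 y
        Measure.isProbabilityMeasure_map measurable_prodMk_left.aemeasurable
    have h3 : ∀ (t : ℕ) (i : List ℕ) (x : ℕ → S), IsProbabilityMeasure
        ((resampleLaw P t x).bind fun y => (nestedLaw P N n k i y).map (Prod.mk y)) :=
      fun t i x => isProbabilityMeasure_bind _ (h1 i) (h2 i)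
    have h4 : ∀ (t : ℕ) (i : List ℕ), Measurable fun x : ℕ → S =>
        ((resampleLaw P t x).bind fun y => (nestedLaw P N n k i y).map (Prod.mk y)) :=
      fun t i => (Measure.measurable_bind' (h1 i)).comp (measurable_resampleLaw P t)
    have := (ih (i ++ [1])).2
    constructor
    · let K₁ : Kernel (ℕ → S) _ := ⟨_, (ih (i ++ [1])).1⟩
      let K₂ : Kernel (ℕ → S) _ := ⟨_, measurable_measurePi
        (fun (t : Fin N) x => Measure.pi fun j : Fin (n i (k + 1)) =>
        (resampleLaw P (t.1 + 1) x).bind fun y =>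
          (nestedLaw P N n k (i ++ [j.1 + 2]) y).map (Prod.mk y))
        (fun t => measurable_measurePi _ fun j => h4 _ _)⟩
      have : IsMarkovKernel K₁ := ⟨fun x => (ih (i ++ [1])).2 x⟩
      have : IsMarkovKernel K₂ := ⟨fun x => by
        change IsProbabilityMeasure (Measure.pi _); infer_instance⟩
      change Measurable fun x => (K₁ x).prod (K₂ x)
      have h5 : ⇑(K₁ ×ₖ K₂) = fun x => (K₁ x).prod (K₂ x) :=
        funext fun x => Kernel.prod_apply K₁ K₂ x
      exact h5 ▸ (K₁ ×ₖ K₂).measurable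
    · intro x
      change IsProbabilityMeasure (Measure.prod _ _)
      infer_instance

instance (N K : ℕ) (n : List ℕ → ℕ → ℕ) (s : S) :
    IsProbabilityMeasure (estimatorLaw P N K n s) := by
  have h : ∀ k i, IsProbabilityMeasure ((pathLaw P s).bind fun x =>
      (nestedLaw P N n k i x).map (Prod.mk x)) := fun k i =>
    isProbabilityMeasure_bind _
      (measurable_map_prodMk (nestedLaw_aux P N n k i).1 (nestedLaw_aux P N n k i).2)
      fun x => have := (nestedLaw_aux P N n k i).2 x
        Measure.isProbabilityMeasure_map measurable_prodMk_left.aemeasurable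
  unfold estimatorLaw
  infer_instance

end WellDefined

section Estimator

variable {S : Type u} (R : S → ℝ) (γ Rl Ru : ℝ) (N K : ℕ) (n : List ℕ → ℕ → ℕ)

/-- `σ = σ_H ∧ N`, where `σ_H` is the first time `t ≥ 1` at which `R(Sₜ) ∉ [Rl, Ru]`. -/
noncomputable def stopTime (x : ℕ → S) : ℕ :=
  sInf {t : ℕ | t = N ∨ (1 ≤ t ∧ R (x t) ∉ Set.Icc Rl Ru)}

/-- `Zₜ(ν) = (1-γ) / (2 (Ru - Rl) (1 - γ^N)) * ∑_{u=0}^{(t ∧ σ) - 1} γ^u (ν - R(S_u))`. -/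
noncomputable def cost (x : ℕ → S) (t : ℕ) (ν : ℝ) : ℝ :=
  (1 - γ) / (2 * (Ru - Rl) * (1 - γ ^ N)) *
    ∑ u ∈ Finset.range (min t (stopTime R Rl Ru N x)), γ ^ u * (ν - R (x u))

/-- `Z^{(k+1)}_{i,t+1,n}(ν)` for `t : Fin N`, as a function of the path `S^i` and of the
resampled paths. The infimum over `Fin N` is a minimum over a finite set. -/
noncomputable def nestedCost : (k : ℕ) → (i : List ℕ) → (ℕ → S) → NestedSample S N n k i →
    Fin N → ℝ → ℝ
  | 0, _, x, _, t, ν => cost R γ Rl Ru N x (t.1 + 1) ν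
  | k + 1, i, x, w, t, ν => nestedCost k (i ++ [1]) x w.1 t ν -
      1 / (n i (k + 1) : ℝ) * ∑ j : Fin (n i (k + 1)),
        ⨅ v : Fin N, nestedCost k (i ++ [j.1 + 2]) (w.2 t j).1 (w.2 t j).2 v ν

/-- The estimator `V_s(ν)`, projected on `[-1/2, 1/2]`, as a function of the sampled data. -/
noncomputable def estimator (ν : ℝ) (w : EstimatorSample S N K n) : ℝ :=
  max (-1 / 2) (min (1 / 2) (1 / (n [K] K : ℝ) * ∑ j : Fin (n [K] K), ∑ k : Fin K,
    ⨅ v : Fin N, nestedCost R γ Rl Ru N n k.1 [k.1 + 1, j.1 + 1] (w j k).1 (w j k).2 v ν))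

/-- The mean `f̃_s(ν) = E_s[V_s(ν)]`. -/
noncomputable def meanEstimator [MeasurableSpace S] (P : Kernel S S) [IsMarkovKernel P] (s : S)
    (ν : ℝ) : ℝ :=
  ∫ w, estimator R γ Rl Ru N K n ν w ∂(estimatorLaw P N K n s)

/-- The stochastic approximation iterates
`ν_{m+1} = ν_m - α_m V_{s,m}(ν_m)`, where `V_{s,m}` is computed from the data `X m`. -/
noncomputable def iterate {Ω : Type*} (ν₀ : ℝ) (α : ℕ → Ω → ℝ)
    (X : ℕ → Ω → EstimatorSample S N K n) : ℕ → Ω → ℝ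
  | 0, _ => ν₀
  | m + 1, ω => iterate ν₀ α X m ω -
      α m ω * estimator R γ Rl Ru N K n (iterate ν₀ α X m ω) (X m ω)

end Estimator

/-- `E` is an internally chain transitive invariant set of the autonomous scalar differential
equation `y' = g(y)`. -/
def IsInternallyChainTransitiveInvariant (g : ℝ → ℝ) (E : Set ℝ) : Prop :=
  IsClosed E ∧
  (∀ y : ℝ → ℝ, IsIntegralCurve y (fun _ => g) → y 0 ∈ E → ∀ x : ℝ, y x ∈ E) ∧
  (∀ a ∈ E, ∀ b ∈ E, ∀ ε > 0, ∀ T > 0, ∃ (l : ℕ) (p : ℕ → ℝ), 1 ≤ l ∧ p 0 = a ∧ p l = b ∧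
    (∀ i ≤ l, p i ∈ E) ∧
    ∀ i < l, ∃ y : ℝ → ℝ, IsIntegralCurve y (fun _ => g) ∧ y 0 = p i ∧
      ∃ x ≥ T, |y x - p (i + 1)| < ε)

end SBGIA

/-!
The mean field `f = meanEstimator` is Lipschitz and the iterates are scalar, so the limit set can be
identified explicitly: almost surely the iterates converge to the interval `E` between their lower
and their upper limit, and `f` vanishes on `E`. All trajectories of `y' = -f(y)` through points of
`E` are then constant, by uniqueness for Lipschitz fields, and any two points of `E` are joined by a
chain of equilibria with small jumps, so that `E` is internally chain transitive and invariant
(`isInternallyChainTransitiveInvariant_Icc`).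

That `f` vanishes on `E` rests on three facts.

* *The noise is summable.* `V(νₘ) - f(νₘ)` is a bounded sequence of martingale differences, since
  the sample is independent of the past (`condExp_eq_zero_of_indep`). Switching the weights off once
  their square sum exceeds a constant gives an `L²`-bounded martingale, so
  `∑ αₘ (V(νₘ) - f(νₘ))` converges almost surely (`ae_exists_tendsto_sum_of_summable_sq`).

* *The iterates are bounded.* Almost surely every resampled path does agree with the original path
  up to the resampling time (`ae_estimatorLaw_isConsistent`). For `ν` above `R(s)` and `Ru` all
  summands of the costs are nonnegative, so that all costs are minimal at the first time; for `ν`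
  below `R(s)` and `Rl` they are minimal at the last time. In both cases the minima at all levels
  but the first vanish (`nestedCost_nonneg_and_eq_zero`), so the estimator has the sign of the
  first-level costs: it is nonnegative for large and nonpositive for small `ν`. Hence the recursion
  points back to a bounded interval (`abs_le_of_confining`).

* *No crossing against the drift.* If `f(p) ≠ 0`, then near `p` the drift has a fixed sign, and once
  the noise tails and the steps are small, the iterates can cross a neighbourhood of `p` only in the
  direction of the drift, and cannot stay in it because `∑ αₘ = ∞`. They therefore finally stay on
  one side of `p`, at a positive distance (`eventually_away_of_ne_zero`), and `p ∉ E`.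
-/

namespace SBGIA

universe u

/-! ### Recursions with a drift on the real line -/

/-- If the drift `g` of the recursion `z (m + 1) = z m - a m * g m` is bounded below by `δ > 0`
whenever `z m ∈ [c, d]`, and the increments are eventually at most half as long as `[c, d]`, then
`z` cannot recross this interval upwards, and, as `∑ a m = ∞`, cannot stay in it. -/
theorem eventually_le_or_lt_of_drift {z a g : ℕ → ℝ} {c d δ : ℝ} (hδ : 0 < δ)
    (hz : ∀ m, z (m + 1) = z m - a m * g m) (ha : ∀ m, 0 ≤ a m)
    (hsum : Tendsto (fun M => ∑ m ∈ Finset.range M, a m) atTop atTop)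
    (hg : ∀ᶠ m in atTop, z m ∈ Set.Icc c d → δ ≤ g m)
    (hstep : ∀ᶠ m in atTop, |a m * g m| ≤ (d - c) / 2) :
    (∀ᶠ m in atTop, z m ≤ (c + d) / 2) ∨ ∀ᶠ m in atTop, d < z m := by
  obtain ⟨M, hM⟩ := eventually_atTop.1 (hg.and hstep)
  have hcd : c ≤ d := by
    have := (abs_nonneg _).trans (hM M le_rfl).2
    linarith
  -- every level `q` in the upper half of `[c, d]` is a barrier against upcrossings
  have trap : ∀ q, (c + d) / 2 ≤ q → q ≤ d → ∀ m₀ ≥ M, z m₀ ≤ q → ∀ m ≥ m₀, z m ≤ q := by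
    intro q hq hqd m₀ hm₀ h₀ m hm
    induction m, hm using Nat.le_induction with
    | base => exact h₀
    | succ m hm ih =>
      obtain ⟨h1, h2⟩ := hM m (hm₀.trans hm)
      rw [hz]
      rcases le_total c (z m) with h | h
      · have := mul_nonneg (ha m) (hδ.le.trans (h1 ⟨h, ih.trans hqd⟩))
        linarith
      · have := (abs_le.1 h2).1
        linarith
  by_cases h : ∃ m₀ ≥ M, z m₀ ≤ d
  · left
    obtain ⟨m₀, hm₀, h₀⟩ := h
    by_cases h' : ∃ m₁ ≥ m₀, z m₁ ≤ (c + d) / 2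
    · obtain ⟨m₁, hm₁, h₁⟩ := h'
      filter_upwards [eventually_ge_atTop m₁] with m hm
      exact trap _ le_rfl (by linarith) m₁ (hm₀.trans hm₁) h₁ m hm
    · exfalso
      push Not at h'
      have hup := trap d (by linarith) le_rfl m₀ hm₀ h₀
      have hdec : ∀ m ≥ m₀, z m + δ * ∑ j ∈ Finset.range m, a j ≤
          z m₀ + δ * ∑ j ∈ Finset.range m₀, a j := by
        intro m hm
        induction m, hm using Nat.le_induction with
        | base => exact le_rfl
        | succ m hm ih =>
          have h1 := (hM m (hm₀.trans hm)).1 ⟨by linarith [h' m hm], hup m hm⟩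
          have h2 := mul_le_mul_of_nonneg_left h1 (ha m)
          rw [hz, Finset.sum_range_succ]
          linarith
      obtain ⟨m, h1, h2⟩ := ((eventually_ge_atTop m₀).and
        ((hsum.const_mul_atTop hδ).eventually_gt_atTop
          (z m₀ + δ * ∑ j ∈ Finset.range m₀, a j - (c + d) / 2))).exists
      linarith [hdec m h1, h' m h1]
  · right
    push Not at h
    filter_upwards [eventually_ge_atTop M] with m hm using h m hm

theorem eventually_away_of_pos {f : ℝ → ℝ} {F p : ℝ} (hf : ContinuousAt f p)
    (hF : ∀ y, |f y| ≤ F) {x a ξ : ℕ → ℝ}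
    (hx : ∀ m, x (m + 1) = x m - a m * (f (x m) + ξ m)) (ha : ∀ m, 0 ≤ a m)
    (hsum : Tendsto (fun M => ∑ m ∈ Finset.range M, a m) atTop atTop)
    (ha0 : Tendsto a atTop (𝓝 0))
    (hξ : ∃ c, Tendsto (fun M => ∑ m ∈ Finset.range M, a m * ξ m) atTop (𝓝 c)) (hp : 0 < f p) :
    ∃ r > 0, (∀ᶠ m in atTop, x m ≤ p - r) ∨ ∀ᶠ m in atTop, p + r ≤ x m := by
  obtain ⟨c, hc⟩ := hξ
  obtain ⟨ρ, hρ, hfρ⟩ := Metric.eventually_nhds_iff.1 (hf.eventually_const_lt (half_lt_self hp))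
  obtain ⟨r, rfl⟩ : ∃ r, ρ = 6 * r := ⟨ρ / 6, by ring⟩
  have hr : 0 < r := by linarith
  -- adding the tail of the noise series to `x` removes the noise from the recursion
  let z : ℕ → ℝ := fun m => x m + (∑ j ∈ Finset.range m, a j * ξ j - c)
  have hz : ∀ m, z (m + 1) = z m - a m * f (x m) := fun m => by
    simp only [z, hx, Finset.sum_range_succ]; ring
  have hxz : ∀ᶠ m in atTop, |z m - x m| < r / 2 := by
    have : Tendsto (fun M => ∑ m ∈ Finset.range M, a m * ξ m - c) atTop (𝓝 0) := by
      simpa using hc.sub_const c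
    filter_upwards [this.abs.eventually_lt_const (u := r / 2) (by simpa using hr)] with m hm
    simpa [z] using hm
  have hstep : ∀ᶠ m in atTop, |a m * f (x m)| ≤ (p + r - (p - 3 * r)) / 2 := by
    have : Tendsto (fun m => a m * F) atTop (𝓝 0) := by simpa using ha0.mul_const F
    filter_upwards [this.eventually_lt_const hr] with m hm
    rw [abs_mul, abs_of_nonneg (ha m)]
    nlinarith [mul_le_mul_of_nonneg_left (hF (x m)) (ha m)]
  have hdrift : ∀ᶠ m in atTop, z m ∈ Set.Icc (p - 3 * r) (p + r) → f p / 2 ≤ f (x m) := by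
    filter_upwards [hxz] with m hm hmem
    refine (hfρ ?_).le
    rw [abs_lt] at hm
    rw [Real.dist_eq, abs_lt]
    constructor <;> linarith [hmem.1, hmem.2, hm.1, hm.2]
  refine ⟨r / 2, by linarith, ?_⟩
  refine (eventually_le_or_lt_of_drift (half_pos hp) hz ha hsum hdrift hstep).imp ?_ ?_ <;>
  · intro h
    filter_upwards [h, hxz] with m h1 h2
    rw [abs_lt] at h2
    linarith [h2.1, h2.2]

/-- A Robbins-Monro sequence whose weighted noise series converges eventually stays away from each
point at which the mean field does not vanish, and on one side of it. -/
theorem eventually_away_of_ne_zero {f : ℝ → ℝ} {F p : ℝ} (hf : ContinuousAt f p)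
    (hF : ∀ y, |f y| ≤ F) {x a ξ : ℕ → ℝ}
    (hx : ∀ m, x (m + 1) = x m - a m * (f (x m) + ξ m)) (ha : ∀ m, 0 ≤ a m)
    (hsum : Tendsto (fun M => ∑ m ∈ Finset.range M, a m) atTop atTop)
    (ha0 : Tendsto a atTop (𝓝 0))
    (hξ : ∃ c, Tendsto (fun M => ∑ m ∈ Finset.range M, a m * ξ m) atTop (𝓝 c)) (hp : f p ≠ 0) :
    ∃ r > 0, (∀ᶠ m in atTop, x m ≤ p - r) ∨ ∀ᶠ m in atTop, p + r ≤ x m := by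
  rcases hp.lt_or_gt with h | h
  · obtain ⟨c, hc⟩ := hξ
    -- reflect the line
    obtain ⟨r, hr, h⟩ := eventually_away_of_pos (f := fun y => -f (-y)) (p := -p) (F := F)
      (x := fun m => -x m) (a := a) (ξ := fun m => -ξ m)
      (ContinuousAt.neg (ContinuousAt.comp (g := f) (by simpa using hf) continuousAt_neg))
      (fun y => by simpa using hF (-y))
      (fun m => by simp only [hx, neg_neg]; ring) ha hsum ha0
      ⟨-c, by simpa using hc.neg⟩ (by simpa using h)
    refine ⟨r, hr, h.symm.imp ?_ ?_⟩ <;>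
    · intro h
      filter_upwards [h] with m hm
      linarith
  · exact eventually_away_of_pos hf hF hx ha hsum ha0 hξ h

/-- A recursion `x (m + 1) = x m - a m * v m` with bounded coefficients stays bounded if `v` points
towards `[-B, B]` whenever `x` is outside of this interval. -/
theorem abs_le_of_confining {x a v : ℕ → ℝ} {A B C : ℝ} (hB : |x 0| ≤ B)
    (hx : ∀ m, x (m + 1) = x m - a m * v m) (ha : ∀ m, 0 ≤ a m) (haA : ∀ m, a m ≤ A)
    (hv : ∀ m, |v m| ≤ C) (hpos : ∀ m, B ≤ x m → 0 ≤ v m) (hneg : ∀ m, x m ≤ -B → v m ≤ 0)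
    (m : ℕ) : |x m| ≤ B + A * C := by
  have hB0 : 0 ≤ B := (abs_nonneg _).trans hB
  have hstep : ∀ m, |a m * v m| ≤ A * C := fun m => by
    rw [abs_mul, abs_of_nonneg (ha m)]
    exact mul_le_mul (haA m) (hv m) (abs_nonneg _) ((ha m).trans (haA m))
  induction m with
  | zero => linarith [(abs_nonneg _).trans (hstep 0)]
  | succ m ih =>
    have h := abs_le.1 (hstep m)
    rw [abs_le] at ih ⊢
    rw [hx]
    rcases le_or_gt B (x m) with h1 | h1
    · have := mul_nonneg (ha m) (hpos m h1)
      constructor <;> linarith [h.1, h.2, ih.1, ih.2]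
    · rcases le_or_gt (x m) (-B) with h2 | h2
      · have := mul_nonneg (ha m) (neg_nonneg.2 (hneg m h2))
        constructor <;> linarith [h.1, h.2, ih.1, ih.2]
      · constructor <;> linarith [h.1, h.2, ih.1, ih.2]

/-! ### Sets of equilibria on the real line -/

/-- A compact interval of equilibria of a Lipschitz field is an internally chain transitive
invariant set: its trajectories are constant, and chains with small jumps connect its points. -/
theorem isInternallyChainTransitiveInvariant_Icc {g : ℝ → ℝ} {L : NNReal} (hg : LipschitzWith L g)
    {c d : ℝ} (h0 : ∀ p ∈ Set.Icc c d, g p = 0) :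
    IsInternallyChainTransitiveInvariant g (Set.Icc c d) := by
  have hconst : ∀ p ∈ Set.Icc c d, IsIntegralCurve (fun _ : ℝ => p) (fun _ => g) := by
    intro p hp t
    simpa [h0 p hp] using hasDerivAt_const t p
  refine ⟨isClosed_Icc, fun y hy hy0 x => ?_, fun p hp q hq ε hε T hT => ?_⟩
  · have : y = fun _ => y 0 := ODE_solution_unique_univ (v := fun _ => g) (s := fun _ => Set.univ)
      (t₀ := 0) (fun _ => hg.lipschitzOnWith) (fun t => ⟨hy t, trivial⟩)
      (fun t => ⟨hconst _ hy0 t, trivial⟩) rfl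
    rw [this]
    exact hy0
  · obtain ⟨l, hl⟩ := exists_nat_gt (|q - p| / ε)
    have hl0 : (0 : ℝ) < l := (div_nonneg (abs_nonneg _) hε.le).trans_lt hl
    have hmem : ∀ i ≤ l, p + (i : ℝ) / l * (q - p) ∈ Set.Icc c d := fun i hi => by
      have hi' : (i : ℝ) / l ≤ 1 := (div_le_one hl0).2 (by exact_mod_cast hi)
      exact (convex_Icc c d).add_smul_sub_mem hp hq
        (t := (i : ℝ) / l) ⟨div_nonneg i.cast_nonneg hl0.le, hi'⟩
    refine ⟨l, fun i => p + (i : ℝ) / l * (q - p), by exact_mod_cast hl0, by simp,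
      by field_simp; ring, hmem, fun i hi => ⟨_, hconst _ (hmem i hi.le), rfl, T, le_rfl, ?_⟩⟩
    have : p + (i : ℝ) / l * (q - p) - (p + ((i + 1 : ℕ) : ℝ) / l * (q - p)) = -((q - p) / l) := by
      push_cast; field_simp; ring
    rw [this, abs_neg, abs_div, abs_of_pos hl0, div_lt_iff₀ hl0]
    rwa [div_lt_iff₀ hε, mul_comm] at hl

/-- A bounded real sequence that eventually avoids a neighbourhood of each point where `f ≠ 0`,
staying on one side, converges to an interval of zeros of `f`, namely the interval between its
lower and upper limits. -/
theorem exists_Icc_tendsto_infDist {f : ℝ → ℝ} {x : ℕ → ℝ} {C : ℝ} (hC : ∀ m, |x m| ≤ C)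
    (h : ∀ p, f p ≠ 0 →
      ∃ r > 0, (∀ᶠ m in atTop, x m ≤ p - r) ∨ ∀ᶠ m in atTop, p + r ≤ x m) :
    ∃ c d, c ≤ d ∧ (∀ p ∈ Set.Icc c d, f p = 0) ∧
      Tendsto (fun m => Metric.infDist (x m) (Set.Icc c d)) atTop (𝓝 0) := by
  have hba : IsBoundedUnder (· ≤ ·) atTop x := isBoundedUnder_of ⟨C, fun m => (abs_le.1 (hC m)).2⟩
  have hbb : IsBoundedUnder (· ≥ ·) atTop x := isBoundedUnder_of ⟨-C, fun m => (abs_le.1 (hC m)).1⟩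
  have hle : liminf x atTop ≤ limsup x atTop := liminf_le_limsup hba hbb
  refine ⟨liminf x atTop, limsup x atTop, hle, fun p hp => ?_, ?_⟩
  · by_contra hne
    obtain ⟨r, hr, h | h⟩ := h p hne
    · have := limsup_le_of_le hbb.isCoboundedUnder_le h
      linarith [hp.2]
    · have := le_liminf_of_le hba.isCoboundedUnder_ge h
      linarith [hp.1]
  · refine Metric.tendsto_atTop.2 fun ε hε => eventually_atTop.1 ?_
    filter_upwards [eventually_lt_of_limsup_lt (lt_add_of_pos_right _ hε) hba,
      eventually_lt_of_lt_liminf (sub_lt_self _ hε) hbb] with m h1 h2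
    rw [Real.dist_0_eq_abs, abs_of_nonneg Metric.infDist_nonneg]
    -- the projection of `x m` to the interval is closer than `ε`
    have hmem : max (liminf x atTop) (min (x m) (limsup x atTop)) ∈
        Set.Icc (liminf x atTop) (limsup x atTop) :=
      ⟨le_max_left _ _, max_le hle (min_le_right _ _)⟩
    refine (Metric.infDist_le_dist_of_mem hmem).trans_lt ?_
    rw [Real.dist_eq, abs_lt]
    rcases max_cases (liminf x atTop) (min (x m) (limsup x atTop)) with h | h <;>
    rcases min_cases (x m) (limsup x atTop) with h' | h' <;>
    constructor <;> linarith [h.1, h.2, h'.1, h'.2]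

/-! ### The stopping time -/

section StopTime

variable {S : Type u} (R : S → ℝ) (Rl Ru : ℝ) (N : ℕ)

theorem lt_stopTime_iff (x : ℕ → S) (v : ℕ) :
    v < stopTime R Rl Ru N x ↔ v < N ∧ ∀ u, 1 ≤ u → u ≤ v → R (x u) ∈ Set.Icc Rl Ru := by
  have hne : {t : ℕ | t = N ∨ (1 ≤ t ∧ R (x t) ∉ Set.Icc Rl Ru)}.Nonempty := ⟨N, Or.inl rfl⟩
  rw [stopTime, ← Nat.succ_le_iff, le_csInf_iff' hne]
  constructor
  · intro h
    refine ⟨h (Or.inl rfl), fun u hu huv => ?_⟩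
    by_contra hR
    have : v + 1 ≤ u := h (Or.inr ⟨hu, hR⟩)
    omega
  · rintro ⟨h1, h2⟩ t (rfl | ⟨ht, hR⟩)
    · exact h1
    · by_contra hlt
      exact hR (h2 t ht (by omega))

/-- `t ∧ σ` depends only on the path up to time `t`. -/
theorem min_stopTime_congr {x y : ℕ → S} {t : ℕ} (h : ∀ u ≤ t, y u = x u) :
    min t (stopTime R Rl Ru N y) = min t (stopTime R Rl Ru N x) := by
  refine eq_of_forall_lt_iff fun v => ?_
  rw [lt_min_iff, lt_min_iff, lt_stopTime_iff, lt_stopTime_iff]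
  refine and_congr_right fun hv => and_congr_right fun _ => ?_
  refine forall_congr' fun u => imp_congr_right fun _ => imp_congr_right fun hu => ?_
  rw [h u (by omega)]

end StopTime

/-! ### Dependence of the estimator on the parameter -/

theorem lipschitzWith_iInf {ι : Type*} [Finite ι] {f : ι → ℝ → ℝ} {L : NNReal}
    (h : ∀ v, LipschitzWith L (f v)) : LipschitzWith L fun ν => ⨅ v, f v ν := by
  rcases isEmpty_or_nonempty ι with hι | hι
  · simpa [Real.iInf_of_isEmpty] using LipschitzWith.const' (0 : ℝ)
  · refine LipschitzWith.of_le_add_mul L fun a b => ?_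
    rw [← sub_le_iff_le_add]
    refine le_ciInf fun v => ?_
    have h1 := ciInf_le (Set.finite_range fun v => f v a).bddBelow v
    have h2 := (h v).le_add_mul a b
    linarith

theorem lipschitzWith_mean {m : ℕ} {f : Fin m → ℝ → ℝ} {L : NNReal}
    (h : ∀ j, LipschitzWith L (f j)) : LipschitzWith L fun ν => 1 / (m : ℝ) * ∑ j, f j ν := by
  refine LipschitzWith.of_le_add_mul L fun a b => ?_
  rcases m.eq_zero_or_pos with rfl | hm
  · simpa using mul_nonneg L.2 dist_nonneg
  have hm' : (0 : ℝ) < m := by exact_mod_cast hm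
  have : ∑ j, f j a ≤ ∑ j, f j b + m * (L * dist a b) := by
    calc ∑ j, f j a ≤ ∑ j, (f j b + L * dist a b) :=
          Finset.sum_le_sum fun j _ => (h j).le_add_mul a b
      _ = _ := by simp [Finset.sum_add_distrib]
  calc 1 / (m : ℝ) * ∑ j, f j a ≤ 1 / (m : ℝ) * (∑ j, f j b + m * (L * dist a b)) := by gcongr
    _ = _ := by field_simp

theorem lipschitzWith_sum {ι : Type*} (s : Finset ι) {f : ι → ℝ → ℝ} {L : ι → NNReal}
    (h : ∀ j, LipschitzWith (L j) (f j)) :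
    LipschitzWith (∑ j ∈ s, L j) fun ν => ∑ j ∈ s, f j ν := by
  induction s using Finset.cons_induction with
  | empty => simp
  | cons j s hj ih => simpa only [Finset.sum_cons] using (h j).add ih

section Lipschitz

variable {S : Type u} (R : S → ℝ) (γ Rl Ru : ℝ) (N K : ℕ) (n : List ℕ → ℕ → ℕ)

theorem exists_lipschitzWith_cost : ∃ L, ∀ (x : ℕ → S) (t : ℕ),
    LipschitzWith L (cost R γ Rl Ru N x t) := by
  set c := (1 - γ) / (2 * (Ru - Rl) * (1 - γ ^ N)) with hc
  refine ⟨Real.nnabs c * ∑ u ∈ Finset.range N, Real.nnabs (γ ^ u), fun x t => ?_⟩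
  refine LipschitzWith.of_le_add_mul _ fun a b => ?_
  set s := min t (stopTime R Rl Ru N x)
  have hs : Finset.range s ⊆ Finset.range N := by
    refine Finset.range_subset_range.2 ((min_le_right _ _).trans ?_)
    by_contra h
    exact lt_irrefl _ ((lt_stopTime_iff R Rl Ru N x N).1 (not_le.1 h)).1
  have h1 : cost R γ Rl Ru N x t a - cost R γ Rl Ru N x t b =
      c * (∑ u ∈ Finset.range s, γ ^ u) * (a - b) := by
    unfold cost
    rw [← hc, ← mul_sub, ← Finset.sum_sub_distrib, mul_assoc, Finset.sum_mul]
    exact congrArg _ (Finset.sum_congr rfl fun u _ => by ring)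
  have h2 : |∑ u ∈ Finset.range s, γ ^ u| ≤ ∑ u ∈ Finset.range N, |γ ^ u| :=
    (Finset.abs_sum_le_sum_abs _ _).trans
      (Finset.sum_le_sum_of_subset_of_nonneg hs fun _ _ _ => abs_nonneg _)
  have h3 : c * (∑ u ∈ Finset.range s, γ ^ u) * (a - b) ≤
      |c| * (∑ u ∈ Finset.range N, |γ ^ u|) * |a - b| := by
    refine (le_abs_self _).trans ?_
    rw [abs_mul, abs_mul]
    gcongr
  rw [← sub_le_iff_le_add', h1]
  simpa [Real.dist_eq] using h3

theorem exists_lipschitzWith_nestedCost (k : ℕ) : ∃ L, ∀ (i : List ℕ) (x : ℕ → S)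
    (w : NestedSample S N n k i) (t : Fin N),
    LipschitzWith L (nestedCost R γ Rl Ru N n k i x w t) := by
  induction k with
  | zero =>
    obtain ⟨L, hL⟩ := exists_lipschitzWith_cost R γ Rl Ru N
    exact ⟨L, fun i x w t => hL x _⟩
  | succ k ih =>
    obtain ⟨L, hL⟩ := ih
    exact ⟨L + L, fun i x w t => (hL _ _ _ _).sub
      (lipschitzWith_mean fun j => lipschitzWith_iInf fun v => hL _ _ _ _)⟩

theorem exists_lipschitzWith_estimator : ∃ L, ∀ w : EstimatorSample S N K n,
    LipschitzWith L fun ν => estimator R γ Rl Ru N K n ν w := by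
  choose L hL using exists_lipschitzWith_nestedCost R γ Rl Ru N n
  refine ⟨∑ k : Fin K, L k, fun w => ?_⟩
  refine LipschitzWith.const_max (LipschitzWith.const_min ?_ _) _
  exact lipschitzWith_mean fun j => lipschitzWith_sum _ fun k =>
    lipschitzWith_iInf fun v => hL _ _ _ _ _

theorem abs_estimator_le (ν : ℝ) (w : EstimatorSample S N K n) :
    |estimator R γ Rl Ru N K n ν w| ≤ 1 / 2 := by
  rw [estimator, abs_le]
  refine ⟨by rw [← neg_div]; exact le_max_left _ _, max_le (by norm_num) (min_le_left _ _)⟩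

end Lipschitz

/-! ### Measurability of the estimator -/

section Measurability

variable {S : Type u} [MeasurableSpace S] {R : S → ℝ}
  (γ Rl Ru : ℝ) (N K : ℕ) (n : List ℕ → ℕ → ℕ)

theorem measurable_cost (hR : Measurable R) (t : ℕ) (ν : ℝ) :
    Measurable fun x : ℕ → S => cost R γ Rl Ru N x t ν := by
  have h : ∀ v, MeasurableSet {x : ℕ → S | v < stopTime R Rl Ru N x} := fun v => by
    simp only [lt_stopTime_iff, Set.ofPred_and, Set.ofPred_forall]
    refine (MeasurableSet.const _).inter (.iInter fun u => .iInter fun _ => .iInter fun _ => ?_)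
    exact (hR.comp (measurable_pi_apply u)) measurableSet_Icc
  have heq : (fun x : ℕ → S => cost R γ Rl Ru N x t ν) = fun x =>
      (1 - γ) / (2 * (Ru - Rl) * (1 - γ ^ N)) * ∑ u ∈ Finset.range t,
        {x : ℕ → S | u < stopTime R Rl Ru N x}.indicator (fun x => γ ^ u * (ν - R (x u))) x := by
    funext x
    rw [cost]
    congr 1
    simp only [Set.indicator_apply, Set.mem_ofPred_eq]
    rw [← Finset.sum_filter]
    congr 1
    ext u
    simp
  rw [heq]
  refine (Finset.measurable_sum _ fun u _ => Measurable.indicator ?_ (h u)).const_mul _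
  exact (measurable_const.sub (hR.comp (measurable_pi_apply u))).const_mul _

theorem measurable_nestedCost (hR : Measurable R) (k : ℕ) : ∀ (i : List ℕ) (t : Fin N) (ν : ℝ),
    Measurable fun p : (ℕ → S) × NestedSample S N n k i =>
      nestedCost R γ Rl Ru N n k i p.1 p.2 t ν := by
  induction k with
  | zero => exact fun i t ν => (measurable_cost γ Rl Ru N hR _ ν).comp measurable_fst
  | succ k ih =>
    intro i t ν
    have h1 : Measurable fun p : (ℕ → S) × NestedSample S N n (k + 1) i => (p.1, p.2.1) :=
      measurable_fst.prodMk (measurable_fst.comp measurable_snd)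
    have h2 : ∀ j, Measurable fun p : (ℕ → S) × NestedSample S N n (k + 1) i => p.2.2 t j :=
      fun j => (measurable_pi_apply j).comp ((measurable_pi_apply t).comp
        (measurable_snd.comp measurable_snd))
    refine ((ih _ t ν).comp h1).sub (Measurable.const_mul (Finset.measurable_sum _ fun j _ => ?_) _)
    exact Measurable.iInf fun v => (ih _ v ν).comp (h2 j)

theorem measurable_estimator (hR : Measurable R) (ν : ℝ) :
    Measurable fun w : EstimatorSample S N K n => estimator R γ Rl Ru N K n ν w := by
  refine measurable_const.max (measurable_const.min (Measurable.const_mul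
    (Finset.measurable_sum _ fun j _ => Finset.measurable_sum _ fun k _ =>
      Measurable.iInf fun v => ?_) _))
  exact (measurable_nestedCost γ Rl Ru N n hR k.1 _ v ν).comp
    ((measurable_pi_apply k).comp (measurable_pi_apply j))

/-- Joint measurability, from measurability in the sample and continuity in the parameter. -/
theorem measurable_uncurry_estimator (hR : Measurable R) :
    Measurable fun p : ℝ × EstimatorSample S N K n => estimator R γ Rl Ru N K n p.1 p.2 := by
  obtain ⟨L, hL⟩ := exists_lipschitzWith_estimator R γ Rl Ru N K n
  exact measurable_uncurry_of_continuous_of_measurable (fun w => (hL w).continuous)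
    (measurable_estimator γ Rl Ru N K n hR)

theorem measurable_estimator_comp (hR : Measurable R) {Ω : Type*} {𝒢 : MeasurableSpace Ω}
    {Y : Ω → ℝ} (hY : Measurable Y) {X : Ω → EstimatorSample S N K n} (hX : Measurable X) :
    Measurable fun ω => estimator R γ Rl Ru N K n (Y ω) (X ω) :=
  Measurable.comp (g := fun p : ℝ × EstimatorSample S N K n => estimator R γ Rl Ru N K n p.1 p.2)
    (f := fun ω => (Y ω, X ω)) (measurable_uncurry_estimator γ Rl Ru N K n hR) (hY.prodMk hX)

variable (P : Kernel S S) [IsMarkovKernel P] (s : S)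

theorem integrable_estimator (hR : Measurable R) (ν : ℝ) :
    Integrable (estimator R γ Rl Ru N K n ν) (estimatorLaw P N K n s) :=
  Integrable.of_bound (measurable_estimator γ Rl Ru N K n hR ν).aestronglyMeasurable (1 / 2)
    (ae_of_all _ fun w => abs_estimator_le R γ Rl Ru N K n ν w)

theorem exists_lipschitzWith_meanEstimator (hR : Measurable R) :
    ∃ L, LipschitzWith L (meanEstimator R γ Rl Ru N K n P s) := by
  obtain ⟨L, hL⟩ := exists_lipschitzWith_estimator R γ Rl Ru N K n
  refine ⟨L, LipschitzWith.of_le_add_mul L fun a b => ?_⟩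
  have hb := integrable_estimator γ Rl Ru N K n P s hR b
  calc meanEstimator R γ Rl Ru N K n P s a
      ≤ ∫ w, (estimator R γ Rl Ru N K n b w + L * dist a b) ∂(estimatorLaw P N K n s) :=
        integral_mono (integrable_estimator γ Rl Ru N K n P s hR a)
          (hb.add (integrable_const _)) fun w => (hL w).le_add_mul a b
    _ = _ := by
        rw [integral_add hb (integrable_const _)]
        simp [meanEstimator]

theorem abs_meanEstimator_le (ν : ℝ) : |meanEstimator R γ Rl Ru N K n P s ν| ≤ 1 / 2 := by
  have := norm_integral_le_of_norm_le_const (μ := estimatorLaw P N K n s)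
    (f := estimator R γ Rl Ru N K n ν) (C := 1 / 2)
    (ae_of_all _ fun w => abs_estimator_le R γ Rl Ru N K n ν w)
  simpa [meanEstimator] using this

end Measurability

/-! ### Consistent samples and the sign of the estimator -/

section Consistency

variable {S : Type u}

/-- The sampled data `w` for the path `x` is consistent if every path that has been resampled
conditionally on the first times does agree with the original path up to the respective time. -/
def IsConsistent (N : ℕ) (n : List ℕ → ℕ → ℕ) :
    (k : ℕ) → (i : List ℕ) → (ℕ → S) → NestedSample S N n k i → Prop
  | 0, _, _, _ => True
  | k + 1, i, x, w => IsConsistent N n k (i ++ [1]) x w.1 ∧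
      ∀ (t : Fin N) (j : Fin (n i (k + 1))), (∀ u ≤ t.1 + 1, (w.2 t j).1 u = x u) ∧
        IsConsistent N n k (i ++ [j.1 + 2]) (w.2 t j).1 (w.2 t j).2

variable (R : S → ℝ) (γ Rl Ru : ℝ) (N K : ℕ) (n : List ℕ → ℕ → ℕ)

theorem cost_congr {x y : ℕ → S} {t : ℕ} (h : ∀ u ≤ t, y u = x u) (ν : ℝ) :
    cost R γ Rl Ru N y t ν = cost R γ Rl Ru N x t ν := by
  unfold cost
  rw [min_stopTime_congr R Rl Ru N h]
  congr 1
  refine Finset.sum_congr rfl fun u hu => ?_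
  rw [h u ((Finset.mem_range.1 hu).le.trans (min_le_left _ _))]

/-- If the cost of every path started in `s` is minimal at one and the same time `t₀`, then the
level-two costs are nonnegative and vanish at `t₀`: the subtracted minima are costs at `t₀` of paths
which agree with `x` up to the time under consideration. The corrections of all higher levels are
then minima of nonnegative functions vanishing at `t₀`, so they vanish, and nothing changes. -/
theorem nestedCost_nonneg_and_eq_zero (hn : ∀ i k, 1 ≤ n i k) {s : S} {ν : ℝ} (t₀ : Fin N)
    (h₀ : ∀ (x : ℕ → S) (t : Fin N), x 0 = s →
      cost R γ Rl Ru N x (t₀.1 + 1) ν ≤ cost R γ Rl Ru N x (t.1 + 1) ν)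
    (k : ℕ) : ∀ (i : List ℕ) (x : ℕ → S) (w : NestedSample S N n (k + 1) i), x 0 = s →
      IsConsistent N n (k + 1) i x w →
      (∀ t, 0 ≤ nestedCost R γ Rl Ru N n (k + 1) i x w t ν) ∧
        nestedCost R γ Rl Ru N n (k + 1) i x w t₀ ν = 0 := by
  have hinf : ∀ {f : Fin N → ℝ}, (∀ t, f t₀ ≤ f t) → ⨅ v, f v = f t₀ := fun {f} hf =>
    have : Nonempty (Fin N) := ⟨t₀⟩
    le_antisymm (ciInf_le (Set.finite_range f).bddBelow t₀) (le_ciInf hf)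
  induction k with
  | zero =>
    intro i x w hx hw
    have hm : (0 : ℝ) < n i (0 + 1) := by exact_mod_cast hn i (0 + 1)
    have hy : ∀ t j, (w.2 t j).1 0 = s := fun t j => ((hw.2 t j).1 0 (Nat.zero_le _)).trans hx
    have heq : ∀ t, nestedCost R γ Rl Ru N n (0 + 1) i x w t ν = 1 / (n i (0 + 1) : ℝ) *
        ∑ j, (cost R γ Rl Ru N (w.2 t j).1 (t.1 + 1) ν -
          cost R γ Rl Ru N (w.2 t j).1 (t₀.1 + 1) ν) := fun t => by
      have h1 : ∀ j, cost R γ Rl Ru N (w.2 t j).1 (t.1 + 1) ν = cost R γ Rl Ru N x (t.1 + 1) ν :=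
        fun j => cost_congr R γ Rl Ru N (hw.2 t j).1 ν
      have h2 : ∀ j, ⨅ v : Fin N, cost R γ Rl Ru N (w.2 t j).1 (v.1 + 1) ν =
          cost R γ Rl Ru N (w.2 t j).1 (t₀.1 + 1) ν := fun j =>
        hinf (f := fun v : Fin N => cost R γ Rl Ru N (w.2 t j).1 (v.1 + 1) ν)
          fun v => h₀ _ v (hy t j)
      simp only [nestedCost, h1, h2, Finset.sum_sub_distrib, Finset.sum_const, Finset.card_univ,
        Fintype.card_fin, nsmul_eq_mul]
      field_simp
    refine ⟨fun t => ?_, ?_⟩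
    · rw [heq]
      exact mul_nonneg (by positivity)
        (Finset.sum_nonneg fun j _ => sub_nonneg.2 (h₀ _ t (hy t j)))
    · rw [heq]; simp
  | succ k ih =>
    intro i x w hx hw
    have heq : ∀ t, nestedCost R γ Rl Ru N n (k + 1 + 1) i x w t ν =
        nestedCost R γ Rl Ru N n (k + 1) (i ++ [1]) x w.1 t ν := fun t => by
      have h1 : ∀ j, ⨅ v, nestedCost R γ Rl Ru N n (k + 1) (i ++ [j.1 + 2]) (w.2 t j).1
          (w.2 t j).2 v ν = 0 := fun j => by
        have h2 := ih _ (w.2 t j).1 (w.2 t j).2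
          (((hw.2 t j).1 0 (Nat.zero_le _)).trans hx) (hw.2 t j).2
        rw [hinf (f := fun v => nestedCost R γ Rl Ru N n (k + 1) (i ++ [j.1 + 2]) (w.2 t j).1
          (w.2 t j).2 v ν) fun v => h2.2.le.trans (h2.1 v), h2.2]
      rw [nestedCost]
      simp [h1]
    simp only [heq]
    exact ih _ x w.1 hx hw.1

/-- Under the assumption on the costs of `nestedCost_nonneg_and_eq_zero`, only the first level
contributes to the estimator, by the mean of the costs at `t₀`. -/
theorem sum_iInf_nestedCost_eq (hK : 1 ≤ K) (hn : ∀ i k, 1 ≤ n i k) {s : S} {ν : ℝ} (t₀ : Fin N)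
    (h₀ : ∀ (x : ℕ → S) (t : Fin N), x 0 = s →
      cost R γ Rl Ru N x (t₀.1 + 1) ν ≤ cost R γ Rl Ru N x (t.1 + 1) ν)
    {w : EstimatorSample S N K n}
    (hw : ∀ j k, (w j k).1 0 = s ∧ IsConsistent N n k.1 _ (w j k).1 (w j k).2)
    (j : Fin (n [K] K)) :
    ∑ k : Fin K, ⨅ v : Fin N,
        nestedCost R γ Rl Ru N n k.1 [k.1 + 1, j.1 + 1] (w j k).1 (w j k).2 v ν =
      cost R γ Rl Ru N (w j ⟨0, hK⟩).1 (t₀.1 + 1) ν := by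
  have : Nonempty (Fin N) := ⟨t₀⟩
  rw [Finset.sum_eq_single_of_mem (⟨0, hK⟩ : Fin K) (Finset.mem_univ _)]
  · exact le_antisymm (ciInf_le (Set.finite_range _).bddBelow t₀)
      (le_ciInf fun v => h₀ _ v (hw j _).1)
  · rintro ⟨k, hk⟩ - hne
    obtain ⟨k, rfl⟩ : ∃ k', k = k' + 1 :=
      Nat.exists_eq_succ_of_ne_zero fun h => hne (Fin.ext h)
    have h := nestedCost_nonneg_and_eq_zero R γ Rl Ru N n hn t₀ h₀ k _ _ _
      (hw j ⟨k + 1, hk⟩).1 (hw j ⟨k + 1, hk⟩).2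
    exact le_antisymm ((ciInf_le (Set.finite_range _).bddBelow t₀).trans h.2.le)
      (le_ciInf h.1)

variable {γ Rl Ru N K n}

theorem cost_factor_nonneg (hγ₀ : 0 < γ) (hγ₁ : γ < 1) (hRlu : Rl < Ru) :
    0 ≤ (1 - γ) / (2 * (Ru - Rl) * (1 - γ ^ N)) := by
  have h1 : γ ^ N ≤ 1 := pow_le_one₀ hγ₀.le hγ₁.le
  exact div_nonneg (by linarith) (mul_nonneg (by linarith) (by linarith))

theorem mem_Icc_of_lt_stopTime {x : ℕ → S} {u t : ℕ}
    (hu : u ∈ Finset.range (min t (stopTime R Rl Ru N x))) :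
    u = 0 ∨ R (x u) ∈ Set.Icc Rl Ru := by
  have h := ((lt_stopTime_iff R Rl Ru N x u).1 (lt_min_iff.1 (Finset.mem_range.1 hu)).2).2 u
  rcases u.eq_zero_or_pos with h0 | h0
  · exact Or.inl h0
  · exact Or.inr (h h0 le_rfl)

/-- For large `ν` the costs increase in time, so that they are minimal at the first time. -/
theorem estimator_nonneg (hγ₀ : 0 < γ) (hγ₁ : γ < 1) (hRlu : Rl < Ru) (hN : 1 ≤ N) (hK : 1 ≤ K)
    (hn : ∀ i k, 1 ≤ n i k) {s : S} {w : EstimatorSample S N K n}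
    (hw : ∀ j k, (w j k).1 0 = s ∧ IsConsistent N n k.1 _ (w j k).1 (w j k).2)
    {ν : ℝ} (h1 : R s ≤ ν) (h2 : Ru ≤ ν) : 0 ≤ estimator R γ Rl Ru N K n ν w := by
  have hc := cost_factor_nonneg (N := N) hγ₀ hγ₁ hRlu
  have hterm : ∀ (x : ℕ → S) t, x 0 = s → ∀ u ∈ Finset.range (min t (stopTime R Rl Ru N x)),
      0 ≤ γ ^ u * (ν - R (x u)) := fun x t hx u hu => by
    refine mul_nonneg (by positivity) (sub_nonneg.2 ?_)
    rcases mem_Icc_of_lt_stopTime R hu with rfl | h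
    · rwa [hx]
    · exact h.2.trans h2
  have h₀ : ∀ (x : ℕ → S) (t : Fin N), x 0 = s →
      cost R γ Rl Ru N x (0 + 1) ν ≤ cost R γ Rl Ru N x (t.1 + 1) ν := fun x t hx => by
    refine mul_le_mul_of_nonneg_left (Finset.sum_le_sum_of_subset_of_nonneg
      (Finset.range_subset_range.2 (min_le_min_right _ (by omega)))
      fun u hu _ => hterm x _ hx u hu) hc
  refine le_max_of_le_right (le_min (by norm_num)
    (mul_nonneg (by positivity) (Finset.sum_nonneg fun j _ => ?_)))
  rw [sum_iInf_nestedCost_eq R γ Rl Ru N K n hK hn ⟨0, hN⟩ h₀ hw j]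
  exact mul_nonneg hc (Finset.sum_nonneg (hterm _ _ (hw j _).1))

/-- For small `ν` the costs decrease in time, so that they are minimal at the last time. -/
theorem estimator_nonpos (hγ₀ : 0 < γ) (hγ₁ : γ < 1) (hRlu : Rl < Ru) (hN : 1 ≤ N) (hK : 1 ≤ K)
    (hn : ∀ i k, 1 ≤ n i k) {s : S} {w : EstimatorSample S N K n}
    (hw : ∀ j k, (w j k).1 0 = s ∧ IsConsistent N n k.1 _ (w j k).1 (w j k).2)
    {ν : ℝ} (h1 : ν ≤ R s) (h2 : ν ≤ Rl) : estimator R γ Rl Ru N K n ν w ≤ 0 := by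
  have hc := cost_factor_nonneg (N := N) hγ₀ hγ₁ hRlu
  have hterm : ∀ (x : ℕ → S) t, x 0 = s → ∀ u ∈ Finset.range (min t (stopTime R Rl Ru N x)),
      γ ^ u * (ν - R (x u)) ≤ 0 := fun x t hx u hu => by
    refine mul_nonpos_of_nonneg_of_nonpos (by positivity) (sub_nonpos.2 ?_)
    rcases mem_Icc_of_lt_stopTime R hu with rfl | h
    · rwa [hx]
    · exact h2.trans h.1
  have h₀ : ∀ (x : ℕ → S) (t : Fin N), x 0 = s →
      cost R γ Rl Ru N x (N - 1 + 1) ν ≤ cost R γ Rl Ru N x (t.1 + 1) ν := fun x t hx => by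
    refine mul_le_mul_of_nonneg_left ?_ hc
    rw [← neg_le_neg_iff, ← Finset.sum_neg_distrib, ← Finset.sum_neg_distrib]
    exact Finset.sum_le_sum_of_subset_of_nonneg
      (Finset.range_subset_range.2 (min_le_min_right _ (by omega)))
      fun u hu _ => neg_nonneg.2 (hterm x _ hx u hu)
  refine max_le (by norm_num) (min_le_of_right_le
    (mul_nonpos_of_nonneg_of_nonpos (by positivity) (Finset.sum_nonpos fun j _ => ?_)))
  rw [sum_iInf_nestedCost_eq R γ Rl Ru N K n hK hn ⟨N - 1, by omega⟩ h₀ hw j]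
  exact mul_nonpos_of_nonneg_of_nonpos hc (Finset.sum_nonpos (hterm _ _ (hw j _).1))

end Consistency

/-! ### Samples are almost surely consistent -/

section Law

variable {S : Type u} [MeasurableSpace S] [StandardBorelSpace S] (P : Kernel S S) [IsMarkovKernel P]

theorem ae_traj_eq (t : ℕ) (h : (_ : Finset.Iic t) → S) :
    ∀ᵐ y ∂(Kernel.traj (X := fun _ => S) (step P) t h), Preorder.frestrictLe t y = h := by
  have hmap : (Kernel.traj (X := fun _ => S) (step P) t h).map (Preorder.frestrictLe t) =
      Measure.dirac h := by
    have h1 := Kernel.traj_map_frestrictLe_apply (X := fun _ => S) (κ := step P) t t h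
    rw [h1, Kernel.partialTraj_self, Kernel.id_apply]
  have hd : ∀ᵐ z ∂(Measure.dirac h), z = h := (ae_dirac_iff (measurableSet_singleton h)).2 rfl
  rw [← hmap] at hd
  exact ae_of_ae_map (Preorder.measurable_frestrictLe t).aemeasurable hd

theorem ae_resampleLaw_eq (t : ℕ) (x : ℕ → S) :
    ∀ᵐ y ∂(resampleLaw P t x), ∀ u ≤ t, y u = x u := by
  filter_upwards [ae_traj_eq P t (Preorder.frestrictLe t x)] with y hy u hu
  exact congrFun hy ⟨u, Finset.mem_Iic.2 hu⟩

theorem ae_pathLaw_eq (s : S) : ∀ᵐ y ∂(pathLaw P s), y 0 = s := by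
  filter_upwards [ae_traj_eq P 0 fun _ => s] with y hy
  exact congrFun hy ⟨0, Finset.mem_Iic.2 le_rfl⟩

theorem measurableSet_isConsistent (N : ℕ) (n : List ℕ → ℕ → ℕ) (k : ℕ) : ∀ i : List ℕ,
    MeasurableSet {p : (ℕ → S) × NestedSample S N n k i | IsConsistent N n k i p.1 p.2} := by
  induction k with
  | zero => exact fun i => MeasurableSet.univ
  | succ k ih =>
    intro i
    have h1 : Measurable fun p : (ℕ → S) × NestedSample S N n (k + 1) i => (p.1, p.2.1) :=
      measurable_fst.prodMk (measurable_fst.comp measurable_snd)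
    have h2 : ∀ t j, Measurable fun p : (ℕ → S) × NestedSample S N n (k + 1) i => p.2.2 t j :=
      fun t j => (measurable_pi_apply j).comp ((measurable_pi_apply t).comp
        (measurable_snd.comp measurable_snd))
    refine MeasurableSet.inter (h1 (ih _)) ?_
    change MeasurableSet {p : (ℕ → S) × NestedSample S N n (k + 1) i |
      ∀ (t : Fin N) (j : Fin (n i (k + 1))), (∀ u ≤ t.1 + 1, (p.2.2 t j).1 u = p.1 u) ∧
        IsConsistent N n k (i ++ [j.1 + 2]) (p.2.2 t j).1 (p.2.2 t j).2}
    simp only [Set.ofPred_forall, Set.ofPred_and]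
    refine .iInter fun t => .iInter fun j => .inter (.iInter fun u => .iInter fun _ => ?_)
      (h2 t j (ih _))
    exact measurableSet_eq_fun ((measurable_pi_apply u).comp (measurable_fst.comp (h2 t j)))
      ((measurable_pi_apply u).comp measurable_fst)

theorem ae_bind_of_ae_ae {A B : Type*} [MeasurableSpace A] [MeasurableSpace B] {m : Measure A}
    {κ : A → Measure B} (hκ : Measurable κ) {p : B → Prop} (hp : MeasurableSet {b | p b})
    (h : ∀ᵐ a ∂m, ∀ᵐ b ∂(κ a), p b) : ∀ᵐ b ∂(m.bind κ), p b := by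
  have hp' : MeasurableSet {b | ¬ p b} := hp.compl
  rw [ae_iff, Measure.bind_apply hp' hκ.aemeasurable]
  exact (lintegral_eq_zero_iff ((Measure.measurable_coe hp').comp hκ)).2 h

theorem ae_pi_of_ae {ι : Type*} [Fintype ι] {B : ι → Type*} [∀ i, MeasurableSpace (B i)]
    (m : ∀ i, Measure (B i)) [∀ i, IsProbabilityMeasure (m i)] {i : ι} {p : B i → Prop}
    (h : ∀ᵐ b ∂(m i), p b) : ∀ᵐ f ∂(Measure.pi m), p (f i) :=
  (Measure.quasiMeasurePreserving_eval m i).ae h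

theorem ae_nestedLaw_isConsistent (N : ℕ) (n : List ℕ → ℕ → ℕ) (k : ℕ) :
    ∀ (i : List ℕ) (x : ℕ → S), ∀ᵐ w ∂(nestedLaw P N n k i x), IsConsistent N n k i x w := by
  induction k with
  | zero => exact fun i x => ae_of_all _ fun w => trivial
  | succ k ih =>
    intro i x
    have h1 : ∀ i, Measurable fun y => (nestedLaw P N n k i y).map (Prod.mk y) := fun i =>
      measurable_map_prodMk (nestedLaw_aux P N n k i).1 (nestedLaw_aux P N n k i).2
    have := fun i x => (nestedLaw_aux P N n k i).2 x
    have h2 : ∀ (t : ℕ) (i : List ℕ), IsProbabilityMeasure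
        ((resampleLaw P t x).bind fun y => (nestedLaw P N n k i y).map (Prod.mk y)) := fun t i =>
      isProbabilityMeasure_bind _ (h1 i) fun y =>
        Measure.isProbabilityMeasure_map measurable_prodMk_left.aemeasurable
    have hmeas : ∀ (t : ℕ) (i : List ℕ), MeasurableSet {p : (ℕ → S) × NestedSample S N n k i |
        (∀ u ≤ t, p.1 u = x u) ∧ IsConsistent N n k i p.1 p.2} := fun t i => by
      simp only [Set.ofPred_forall, Set.ofPred_and]
      refine .inter (.iInter fun u => .iInter fun _ => ?_) (measurableSet_isConsistent N n k i)
      exact measurableSet_eq_fun ((measurable_pi_apply u).comp measurable_fst) measurable_const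
    have h3 : ∀ (t : ℕ) (i : List ℕ), ∀ᵐ p ∂((resampleLaw P t x).bind fun y =>
        (nestedLaw P N n k i y).map (Prod.mk y)),
        (∀ u ≤ t, p.1 u = x u) ∧ IsConsistent N n k i p.1 p.2 := fun t i => by
      refine ae_bind_of_ae_ae (h1 i) (hmeas t i) ?_
      filter_upwards [ae_resampleLaw_eq P t x] with y hy
      rw [ae_map_iff measurable_prodMk_left.aemeasurable (hmeas t i)]
      filter_upwards [ih i y] with w hw using ⟨hy, hw⟩
    change ∀ᵐ w ∂(Measure.prod _ _), _
    refine Filter.Eventually.and (Measure.quasiMeasurePreserving_fst.ae (ih _ x)) ?_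
    refine ae_all_iff.2 fun t => ae_all_iff.2 fun j => ?_
    have h4 := ae_pi_of_ae (fun j : Fin (n i (k + 1)) =>
      (resampleLaw P (t.1 + 1) x).bind fun y => (nestedLaw P N n k (i ++ [j.1 + 2]) y).map
        (Prod.mk y)) (h3 (t.1 + 1) (i ++ [j.1 + 2]))
    exact Measure.quasiMeasurePreserving_snd.ae (ae_pi_of_ae
      (fun t : Fin N => Measure.pi fun j : Fin (n i (k + 1)) =>
        (resampleLaw P (t.1 + 1) x).bind fun y =>
          (nestedLaw P N n k (i ++ [j.1 + 2]) y).map (Prod.mk y)) h4)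

theorem ae_estimatorLaw_isConsistent (N K : ℕ) (n : List ℕ → ℕ → ℕ) (s : S) :
    ∀ᵐ w ∂(estimatorLaw P N K n s),
      ∀ j k, (w j k).1 0 = s ∧ IsConsistent N n k.1 _ (w j k).1 (w j k).2 := by
  have h1 : ∀ k i, Measurable fun y => (nestedLaw P N n k i y).map (Prod.mk y) := fun k i =>
    measurable_map_prodMk (nestedLaw_aux P N n k i).1 (nestedLaw_aux P N n k i).2
  have := fun k i x => (nestedLaw_aux P N n k i).2 x
  have h2 : ∀ k i, IsProbabilityMeasure
      ((pathLaw P s).bind fun y => (nestedLaw P N n k i y).map (Prod.mk y)) := fun k i =>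
    isProbabilityMeasure_bind _ (h1 k i) fun y =>
      Measure.isProbabilityMeasure_map measurable_prodMk_left.aemeasurable
  have hmeas : ∀ k i, MeasurableSet {p : (ℕ → S) × NestedSample S N n k i |
      p.1 0 = s ∧ IsConsistent N n k i p.1 p.2} := fun k i =>
    .inter (measurableSet_eq_fun ((measurable_pi_apply 0).comp measurable_fst) measurable_const)
      (measurableSet_isConsistent N n k i)
  have h3 : ∀ k i, ∀ᵐ p ∂((pathLaw P s).bind fun y => (nestedLaw P N n k i y).map (Prod.mk y)),
      p.1 0 = s ∧ IsConsistent N n k i p.1 p.2 := fun k i => by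
    refine ae_bind_of_ae_ae (h1 k i) (hmeas k i) ?_
    filter_upwards [ae_pathLaw_eq P s] with y hy
    rw [ae_map_iff measurable_prodMk_left.aemeasurable (hmeas k i)]
    filter_upwards [ae_nestedLaw_isConsistent P N n k i y] with w hw using ⟨hy, hw⟩
  refine ae_all_iff.2 fun j => ae_all_iff.2 fun k => ?_
  have h4 := ae_pi_of_ae (fun k : Fin K => (pathLaw P s).bind fun x =>
    (nestedLaw P N n k.1 [k.1 + 1, j.1 + 1] x).map (Prod.mk x)) (h3 k.1 [k.1 + 1, j.1 + 1])
  exact ae_pi_of_ae (fun j : Fin (n [K] K) => Measure.pi fun k : Fin K =>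
    (pathLaw P s).bind fun x => (nestedLaw P N n k.1 [k.1 + 1, j.1 + 1] x).map (Prod.mk x)) h4

end Law

/-! ### Convergence of weighted martingale differences -/

section Noise

variable {Ω : Type*} {𝒢 : MeasurableSpace Ω} [mΩ : MeasurableSpace Ω] {μ : Measure Ω}
  [IsProbabilityMeasure μ]

/-- Freezing: a function of a `𝒢`-measurable `Y` and an `X` independent of `𝒢`, which is centred
in `X` for every fixed value of `Y`, is a martingale difference. -/
theorem condExp_eq_zero_of_indep {A B : Type*} [MeasurableSpace A] [MeasurableSpace B]
    (h𝒢 : 𝒢 ≤ mΩ) {Y : Ω → A} (hY : Measurable[𝒢] Y) {X : Ω → B}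
    (hX : Measurable X) (hind : Indep (MeasurableSpace.comap X inferInstance) 𝒢 μ)
    {φ : A × B → ℝ} (hφ : Measurable φ) {C : ℝ} (hC : ∀ p, |φ p| ≤ C)
    (h0 : ∀ y, ∫ x, φ (y, x) ∂(μ.map X) = 0) :
    μ[fun ω => φ (Y ω, X ω) | 𝒢] =ᵐ[μ] 0 := by
  have hYm : Measurable Y := hY.mono h𝒢 le_rfl
  have hint : Integrable (fun ω => φ (Y ω, X ω)) μ :=
    Integrable.of_bound (hφ.comp (hYm.prodMk hX)).aestronglyMeasurable C
      (ae_of_all _ fun ω => hC _)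
  refine (ae_eq_condExp_of_forall_setIntegral_eq h𝒢 hint
    (fun _ _ _ => integrableOn_zero) (fun G hG _ => ?_) aestronglyMeasurable_zero).symm
  -- the indicator of `G` is carried along with `Y`
  let Z : Ω → A × ℝ := fun ω => (Y ω, G.indicator (fun _ => (1 : ℝ)) ω)
  have hZ : Measurable[𝒢] Z := hY.prodMk (measurable_const.indicator hG)
  have hZm : Measurable Z := hZ.mono h𝒢 le_rfl
  have hindep : IndepFun Z X μ := by
    rw [IndepFun_iff_Indep]
    exact (indep_of_indep_of_le_right hind hZ.comap_le).symm
  have hmap := (indepFun_iff_map_prod_eq_prod_map_map hZm.aemeasurable hX.aemeasurable).1 hindep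
  have := Measure.isProbabilityMeasure_map (μ := μ) hZm.aemeasurable
  have := Measure.isProbabilityMeasure_map (μ := μ) hX.aemeasurable
  -- the truncation of the second coordinate only serves to make `ψ` bounded
  let ψ : (A × ℝ) × B → ℝ := fun q => (Set.Icc (-1) 1).indicator id q.1.2 * φ (q.1.1, q.2)
  have hψ : Measurable ψ := ((measurable_id.indicator measurableSet_Icc).comp
    (measurable_snd.comp measurable_fst)).mul
      (hφ.comp ((measurable_fst.comp measurable_fst).prodMk measurable_snd))
  have hψC : ∀ q, |ψ q| ≤ C := fun q => by
    simp only [ψ, abs_mul]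
    refine (mul_le_of_le_one_left (abs_nonneg _) ?_).trans (hC _)
    by_cases h : q.1.2 ∈ Set.Icc (-1 : ℝ) 1
    · simpa [h] using abs_le.2 h
    · simp [h]
  have hψint : Integrable ψ ((μ.map Z).prod (μ.map X)) :=
    Integrable.of_bound hψ.aestronglyMeasurable C (ae_of_all _ hψC)
  have h1 : ∀ ω, ψ (Z ω, X ω) = G.indicator (fun ω => φ (Y ω, X ω)) ω := fun ω => by
    by_cases h : ω ∈ G <;> simp [ψ, Z, h]
  calc ∫ ω in G, (0 : Ω → ℝ) ω ∂μ = 0 := by simp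
    _ = ∫ q, ψ q ∂((μ.map Z).prod (μ.map X)) := by
        rw [integral_prod _ hψint]
        simp only [ψ, integral_const_mul, h0, mul_zero, integral_zero]
    _ = ∫ ω, ψ (Z ω, X ω) ∂μ := by
        rw [← hmap, integral_map (hZm.prodMk hX).aemeasurable hψ.aestronglyMeasurable]
    _ = ∫ ω in G, φ (Y ω, X ω) ∂μ := by
        simp only [h1]
        exact integral_indicator (h𝒢 _ hG)

variable {ℱ : Filtration ℕ mΩ} {α D : ℕ → Ω → ℝ}

theorem condExp_mul_eq_zero {μ : Measure Ω} (h𝒢 : 𝒢 ≤ mΩ) {b d : Ω → ℝ} {B : ℝ}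
    (hb : Measurable[𝒢] b) (hbB : ∀ ω, |b ω| ≤ B) (hd : Integrable d μ) (h : μ[d | 𝒢] =ᵐ[μ] 0) :
    μ[fun ω => b ω * d ω | 𝒢] =ᵐ[μ] 0 := by
  have hbd : Integrable (b * d) μ :=
    hd.bdd_mul (hb.mono h𝒢 le_rfl).aestronglyMeasurable (ae_of_all _ hbB)
  refine (condExp_mul_of_stronglyMeasurable_left hb.stronglyMeasurable hbd hd).trans ?_
  filter_upwards [h] with ω hω
  simp [hω]

/-- Bounded martingale differences with predictable weights of deterministically bounded square
sum: the partial sums are a martingale bounded in `L²`. -/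
theorem ae_exists_tendsto_sum_of_sum_sq_le {C : ℝ}
    (hα : ∀ m, Measurable[ℱ m] (α m)) (hC : ∀ M ω, ∑ m ∈ Finset.range M, α m ω ^ 2 ≤ C)
    (hD : ∀ m, Measurable[ℱ (m + 1)] (D m)) (hD1 : ∀ m ω, |D m ω| ≤ 1)
    (hD0 : ∀ m, μ[D m | ℱ m] =ᵐ[μ] 0) :
    ∀ᵐ ω ∂μ, ∃ c, Tendsto (fun M => ∑ m ∈ Finset.range M, α m ω * D m ω) atTop (𝓝 c) := by
  have hαm : ∀ m, Measurable (α m) := fun m => (hα m).mono (ℱ.le _) le_rfl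
  have hDm : ∀ m, Measurable (D m) := fun m => (hD m).mono (ℱ.le _) le_rfl
  have hDi : ∀ m, Integrable (D m) μ := fun m =>
    Integrable.of_bound (hDm m).aestronglyMeasurable 1 (ae_of_all _ (hD1 m))
  have hαC : ∀ m ω, |α m ω| ≤ √C := fun m ω => by
    refine Real.abs_le_sqrt (le_trans ?_ (hC (m + 1) ω))
    exact Finset.single_le_sum (f := fun m => α m ω ^ 2) (fun _ _ => sq_nonneg _)
      (Finset.self_mem_range_succ m)
  let M : ℕ → Ω → ℝ := fun k ω => ∑ m ∈ Finset.range k, α m ω * D m ω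
  have hMs : ∀ k ω, M (k + 1) ω = M k ω + α k ω * D k ω := fun k ω => Finset.sum_range_succ _ _
  have hMad : ∀ k, Measurable[ℱ k] (M k) := fun k =>
    Finset.measurable_sum _ fun m hm =>
      ((hα m).mono (ℱ.mono (Finset.mem_range.1 hm).le) le_rfl).mul
        ((hD m).mono (ℱ.mono (Finset.mem_range.1 hm)) le_rfl)
  have hMm : ∀ k, Measurable (M k) := fun k => (hMad k).mono (ℱ.le _) le_rfl
  have hMb : ∀ k ω, |M k ω| ≤ k * √C := fun k ω => by
    refine (Finset.abs_sum_le_sum_abs _ _).trans ((Finset.sum_le_card_nsmul _ _ (√C)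
      fun m _ => ?_).trans (by simp))
    rw [abs_mul]
    exact (mul_le_of_le_one_right (abs_nonneg _) (hD1 m ω)).trans (hαC m ω)
  have hint : ∀ {f : Ω → ℝ} {B : ℝ}, Measurable f → (∀ ω, |f ω| ≤ B) → Integrable f μ :=
    fun hf hB => Integrable.of_bound hf.aestronglyMeasurable _ (ae_of_all _ hB)
  have hsq : ∀ {a B : ℝ}, |a| ≤ B → |a ^ 2| ≤ B ^ 2 := fun h => by
    rw [abs_pow]; exact pow_le_pow_left₀ (abs_nonneg _) h 2
  have hα2 : ∀ m, Integrable (fun ω => α m ω ^ 2) μ := fun m =>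
    hint ((hαm m).pow_const 2) fun ω => hsq (hαC m ω)
  have hM2 : ∀ k, Integrable (fun ω => M k ω ^ 2) μ := fun k =>
    hint ((hMm k).pow_const 2) fun ω => hsq (hMb k ω)
  have hmart : Martingale M ℱ μ := by
    refine martingale_of_condExp_sub_eq_zero_nat (fun k => (hMad k).stronglyMeasurable)
      (fun k => hint (hMm k) (hMb k)) fun k => ?_
    have : M (k + 1) - M k = fun ω => α k ω * D k ω := by
      ext ω; simp [hMs]
    rw [this]
    exact condExp_mul_eq_zero (ℱ.le k) (hα k) (hαC k) (hDi k) (hD0 k)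
  -- orthogonality of the increments
  have horth : ∀ k, ∫ ω, M k ω * α k ω * D k ω ∂μ = 0 := fun k => by
    have hb : ∀ ω, |M k ω * α k ω| ≤ k * √C * √C := fun ω => by
      rw [abs_mul]
      exact mul_le_mul (hMb k ω) (hαC k ω) (abs_nonneg _) (by positivity)
    have h := condExp_mul_eq_zero (b := fun ω => M k ω * α k ω) (ℱ.le k) ((hMad k).mul (hα k)) hb
      (hDi k) (hD0 k)
    rw [← integral_condExp (ℱ.le k), integral_congr_ae h]
    simp
  have hbound : ∀ k, ∫ ω, M k ω ^ 2 ∂μ ≤ ∫ ω, ∑ m ∈ Finset.range k, α m ω ^ 2 ∂μ := fun k => by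
    induction k with
    | zero => simp [M]
    | succ k ih =>
      have hcross : Integrable (fun ω => M k ω * α k ω * D k ω) μ :=
        hint (B := k * √C * √C * 1) (((hMm k).mul (hαm k)).mul (hDm k)) fun ω => by
          rw [abs_mul, abs_mul]
          gcongr
          exacts [hMb k ω, hαC k ω, hD1 k ω]
      calc ∫ ω, M (k + 1) ω ^ 2 ∂μ
          ≤ ∫ ω, (M k ω ^ 2 + 2 * (M k ω * α k ω * D k ω) + α k ω ^ 2) ∂μ := by
            refine integral_mono (hM2 _)
              (((hM2 k).add (hcross.const_mul 2)).add (hα2 k)) fun ω => ?_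
            have h1 : D k ω ^ 2 ≤ 1 := by
              have := hsq (hD1 k ω)
              rwa [abs_of_nonneg (sq_nonneg _), one_pow] at this
            have h2 := mul_le_mul_of_nonneg_left h1 (sq_nonneg (α k ω))
            simp only [hMs]
            nlinarith
        _ = ∫ ω, M k ω ^ 2 ∂μ + ∫ ω, α k ω ^ 2 ∂μ := by
            rw [integral_add (f := fun ω => M k ω ^ 2 + 2 * (M k ω * α k ω * D k ω))
              ((hM2 k).add (hcross.const_mul 2)) (hα2 k),
              integral_add (hM2 k) (hcross.const_mul 2), integral_const_mul, horth]
            ring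
        _ ≤ _ := by
            simp only [Finset.sum_range_succ]
            rw [integral_add (integrable_finsetSum _ fun m _ => hα2 m) (hα2 k)]
            gcongr
  have hL1 : ∀ k, eLpNorm (M k) 1 μ ≤ (Real.toNNReal (1 + C) : NNReal) := fun k => by
    rw [eLpNorm_one_eq_lintegral_enorm, ← ofReal_integral_norm_eq_lintegral_enorm
      (hint (hMm k) (hMb k))]
    refine ENNReal.ofReal_le_ofReal ?_
    calc ∫ ω, ‖M k ω‖ ∂μ ≤ ∫ ω, (1 + M k ω ^ 2) ∂μ := by
          refine integral_mono (hint (hMm k) (hMb k)).norm ((integrable_const _).add (hM2 k))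
            fun ω => ?_
          simp only [Real.norm_eq_abs]
          nlinarith [sq_abs (M k ω), sq_nonneg (|M k ω| - 1), abs_nonneg (M k ω)]
      _ = 1 + ∫ ω, M k ω ^ 2 ∂μ := by
          rw [integral_add (integrable_const _) (hM2 k)]; simp
      _ ≤ 1 + C := by
          gcongr
          refine (hbound k).trans ?_
          calc ∫ ω, ∑ m ∈ Finset.range k, α m ω ^ 2 ∂μ ≤ ∫ _, C ∂μ :=
                integral_mono (integrable_finsetSum _ fun m _ => hα2 m) (integrable_const _)
                  fun ω => hC k ω
            _ = C := by simp
  exact hmart.submartingale.exists_ae_tendsto_of_bdd hL1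

/-- Bounded martingale differences with predictable, almost surely square summable weights form
an almost surely convergent series. -/
theorem ae_exists_tendsto_sum_of_summable_sq
    (hα : ∀ m, Measurable[ℱ m] (α m)) (hα2 : ∀ᵐ ω ∂μ, Summable fun m => α m ω ^ 2)
    (hD : ∀ m, Measurable[ℱ (m + 1)] (D m)) (hD1 : ∀ m ω, |D m ω| ≤ 1)
    (hD0 : ∀ m, μ[D m | ℱ m] =ᵐ[μ] 0) :
    ∀ᵐ ω ∂μ, ∃ c, Tendsto (fun M => ∑ m ∈ Finset.range M, α m ω * D m ω) atTop (𝓝 c) := by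
  -- switch the weights off once their square sum exceeds `C`
  let G : ℕ → ℕ → Set Ω := fun C m => {ω | ∑ j ∈ Finset.range (m + 1), α j ω ^ 2 ≤ C}
  have hG : ∀ C m, MeasurableSet[ℱ m] (G C m) := fun C m => by
    have h : Measurable[ℱ m] fun ω => ∑ j ∈ Finset.range (m + 1), α j ω ^ 2 :=
      Finset.measurable_sum _ fun j hj =>
        ((hα j).mono (ℱ.mono (Finset.mem_range_succ_iff.1 hj)) le_rfl).pow_const 2
    exact h measurableSet_Iic
  let β : ℕ → ℕ → Ω → ℝ := fun C m => (G C m).indicator (α m)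
  have hβC : ∀ C M ω, ∑ m ∈ Finset.range M, β C m ω ^ 2 ≤ C := fun C M ω => by
    induction M with
    | zero => simp
    | succ M ih =>
      by_cases h : ω ∈ G C M
      · refine le_trans (Finset.sum_le_sum fun m _ => ?_) h
        by_cases h' : ω ∈ G C m
        · simp [β, h']
        · simp [β, h', sq_nonneg]
      · rw [Finset.sum_range_succ]
        simpa [β, h] using ih
  have hconv : ∀ C : ℕ, ∀ᵐ ω ∂μ, ∃ c,
      Tendsto (fun M => ∑ m ∈ Finset.range M, β C m ω * D m ω) atTop (𝓝 c) := fun C =>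
    ae_exists_tendsto_sum_of_sum_sq_le (fun m => (hα m).indicator (hG C m)) (hβC C) hD hD1 hD0
  filter_upwards [ae_all_iff.2 hconv, hα2] with ω h1 h2
  obtain ⟨C, hC⟩ := exists_nat_ge (∑' m, α m ω ^ 2)
  have hmem : ∀ m, ω ∈ G C m := fun m =>
    (h2.sum_le_tsum _ fun _ _ => sq_nonneg _).trans hC
  simpa [β, hmem] using h1 C

end Noise

/-! ### The iterates -/

section Iterates

variable {S : Type*} [MeasurableSpace S] {R : S → ℝ} (γ Rl Ru : ℝ) (N K : ℕ)
  (n : List ℕ → ℕ → ℕ) (ν₀ : ℝ) {Ω : Type*} {𝒢 : MeasurableSpace Ω}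
  [mΩ : MeasurableSpace Ω] {ℱ : Filtration ℕ mΩ}
  {X : ℕ → Ω → EstimatorSample S N K n} {α : ℕ → Ω → ℝ}

theorem measurable_iterate (hR : Measurable R) (hX : ∀ m, Measurable[ℱ (m + 1)] (X m))
    (hα : ∀ m, Measurable[ℱ m] (α m)) (m : ℕ) :
    Measurable[ℱ m] (iterate R γ Rl Ru N K n ν₀ α X m) := by
  induction m with
  | zero => exact measurable_const
  | succ m ih =>
    have h1 := ih.mono (ℱ.mono m.le_succ) le_rfl
    have h2 := (hα m).mono (ℱ.mono m.le_succ) le_rfl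
    have h3 : Measurable[ℱ (m + 1)] fun ω =>
        estimator R γ Rl Ru N K n (iterate R γ Rl Ru N K n ν₀ α X m ω) (X m ω) :=
      measurable_estimator_comp γ Rl Ru N K n hR h1 (hX m)
    exact h1.sub (h2.mul h3)

/-- The noise of the Robbins-Monro recursion is a sequence of martingale differences. -/
theorem condExp_estimator_sub_meanEstimator (hR : Measurable R) (P : Kernel S S) [IsMarkovKernel P]
    (s : S) {μ : Measure Ω} [IsProbabilityMeasure μ] (h𝒢 : 𝒢 ≤ mΩ)
    {Y : Ω → ℝ} (hY : Measurable[𝒢] Y) {X : Ω → EstimatorSample S N K n} (hX : Measurable X)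
    (hlaw : μ.map X = estimatorLaw P N K n s)
    (hind : Indep (MeasurableSpace.comap X inferInstance) 𝒢 μ) :
    μ[fun ω => estimator R γ Rl Ru N K n (Y ω) (X ω) - meanEstimator R γ Rl Ru N K n P s (Y ω) |
      𝒢] =ᵐ[μ] 0 := by
  obtain ⟨L, hL⟩ := exists_lipschitzWith_meanEstimator γ Rl Ru N K n P s hR
  refine condExp_eq_zero_of_indep h𝒢 hY hX hind (C := 1)
    (φ := fun p => estimator R γ Rl Ru N K n p.1 p.2 - meanEstimator R γ Rl Ru N K n P s p.1)
    ((measurable_uncurry_estimator γ Rl Ru N K n hR).sub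
      (hL.continuous.measurable.comp measurable_fst)) (fun p => ?_) fun y => ?_
  · refine (abs_sub _ _).trans ?_
    linarith [abs_estimator_le R γ Rl Ru N K n p.1 p.2,
      abs_meanEstimator_le (R := R) γ Rl Ru N K n P s p.1]
  · rw [hlaw]
    change ∫ x, (estimator R γ Rl Ru N K n y x - meanEstimator R γ Rl Ru N K n P s y) ∂_ = 0
    rw [integral_sub (integrable_estimator γ Rl Ru N K n P s hR y) (integrable_const _)]
    simp [meanEstimator]

end Iterates

end SBGIA

theorem theorem7 {S : Type*} [MeasurableSpace S] [StandardBorelSpace S]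
    (P : Kernel S S) [IsMarkovKernel P] (R : S → ℝ) (hR : Measurable R)
    (γ : ℝ) (hγ₀ : 0 < γ) (hγ₁ : γ < 1) (Rl Ru : ℝ) (hRlu : Rl < Ru)
    (N K : ℕ) (hN : 1 ≤ N) (hK : 1 ≤ K)
    (n : List ℕ → ℕ → ℕ) (hn : ∀ i k, 1 ≤ n i k) (s : S)
    {Ω : Type*} [mΩ : MeasurableSpace Ω] (μ : Measure Ω) [IsProbabilityMeasure μ]
    -- `ℱ m` is the information available before the `m`-th sample `X m` is drawn
    (ℱ : Filtration ℕ mΩ)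
    (X : ℕ → Ω → SBGIA.EstimatorSample S N K n)
    (hX_meas : ∀ m, Measurable[ℱ (m + 1)] (X m))
    (hX_law : ∀ m, μ.map (X m) = SBGIA.estimatorLaw P N K n s)
    (hX_indep : ∀ m, Indep (MeasurableSpace.comap (X m) inferInstance) (ℱ m) μ)
    -- predictable non-negative step sizes that satisfy the Robbins-Monro conditions
    (α : ℕ → Ω → ℝ) (hα_meas : ∀ m, Measurable[ℱ m] (α m))
    (hα_nonneg : ∀ᵐ ω ∂μ, ∀ m, 0 ≤ α m ω)
    (hα_sum : ∀ᵐ ω ∂μ, Tendsto (fun M : ℕ => ∑ m ∈ Finset.Icc 1 M, α m ω) atTop atTop)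
    (hα_sq : ∀ᵐ ω ∂μ, Summable fun m : ℕ => α (m + 1) ω ^ 2)
    (ν₀ : ℝ) (hν₀ : ν₀ ∈ Set.Icc Rl Ru) :
    ∀ᵐ ω ∂μ, ∃ E : Set ℝ, IsCompact E ∧ IsConnected E ∧
      SBGIA.IsInternallyChainTransitiveInvariant
        (fun ν => -SBGIA.meanEstimator R γ Rl Ru N K n P s ν) E ∧
      Tendsto (fun m => Metric.infDist (SBGIA.iterate R γ Rl Ru N K n ν₀ α X m ω) E)
        atTop (𝓝 0) := by
  open SBGIA in
  obtain ⟨L, hL⟩ := exists_lipschitzWith_meanEstimator γ Rl Ru N K n P s hR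
  have hX : ∀ m, Measurable (X m) := fun m => (hX_meas m).mono (ℱ.le _) le_rfl
  have hit := measurable_iterate γ Rl Ru N K n ν₀ hR hX_meas hα_meas
  let D : ℕ → Ω → ℝ := fun m ω =>
    estimator R γ Rl Ru N K n (iterate R γ Rl Ru N K n ν₀ α X m ω) (X m ω) -
      meanEstimator R γ Rl Ru N K n P s (iterate R γ Rl Ru N K n ν₀ α X m ω)
  have hD : ∀ m, Measurable[ℱ (m + 1)] (D m) := fun m => by
    have h := (hit m).mono (ℱ.mono m.le_succ) le_rfl
    exact (measurable_estimator_comp γ Rl Ru N K n hR h (hX_meas m)).sub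
      (hL.continuous.measurable.comp h)
  have hD1 : ∀ m ω, |D m ω| ≤ 1 := fun m ω => by
    refine (abs_sub _ _).trans ?_
    linarith [abs_estimator_le R γ Rl Ru N K n (iterate R γ Rl Ru N K n ν₀ α X m ω) (X m ω),
      abs_meanEstimator_le (R := R) γ Rl Ru N K n P s (iterate R γ Rl Ru N K n ν₀ α X m ω)]
  have hα2 : ∀ᵐ ω ∂μ, Summable fun m => α m ω ^ 2 := by
    filter_upwards [hα_sq] with ω h using (summable_nat_add_iff 1).1 h
  have hnoise := ae_exists_tendsto_sum_of_summable_sq hα_meas hα2 hD hD1 fun m =>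
    condExp_estimator_sub_meanEstimator γ Rl Ru N K n hR P s (ℱ.le m) (hit m) (hX m) (hX_law m)
      (hX_indep m)
  have hcons : ∀ᵐ ω ∂μ, ∀ m j k, (X m ω j k).1 0 = s ∧
      IsConsistent N n k.1 _ (X m ω j k).1 (X m ω j k).2 := ae_all_iff.2 fun m =>
    ae_of_ae_map (hX m).aemeasurable (by
      rw [hX_law m]; exact ae_estimatorLaw_isConsistent P N K n s)
  filter_upwards [hnoise, hcons, hα_nonneg, hα_sum, hα2] with ω hξ hcons ha hsum hsq
  have ha0 : Tendsto (fun m => α m ω) atTop (𝓝 0) := by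
    have := hsq.tendsto_atTop_zero.sqrt
    simpa [Real.sqrt_sq (ha _)] using this
  have hsum' : Tendsto (fun M => ∑ m ∈ Finset.range M, α m ω) atTop atTop := by
    rw [← tendsto_add_atTop_iff_nat 1]
    refine tendsto_atTop_mono (fun M => ?_) hsum
    refine Finset.sum_le_sum_of_subset_of_nonneg (fun m hm => ?_) fun m _ _ => ha m
    rw [Finset.mem_Icc] at hm
    exact Finset.mem_range_succ_iff.2 hm.2
  obtain ⟨A, hA⟩ := ha0.bddAbove_range
  -- outside of `[-B, B]` the estimator points towards this interval
  set B := max |R s| (max |Rl| |Ru|)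
  have hB1 := abs_le.1 (le_max_left _ _ : |R s| ≤ B)
  have hB2 := abs_le.1 ((le_max_left _ _).trans (le_max_right _ _) : |Rl| ≤ B)
  have hB3 := abs_le.1 ((le_max_right _ _).trans (le_max_right _ _) : |Ru| ≤ B)
  have hbdd := abs_le_of_confining (x := fun m => iterate R γ Rl Ru N K n ν₀ α X m ω)
    (a := fun m => α m ω)
    (v := fun m => estimator R γ Rl Ru N K n (iterate R γ Rl Ru N K n ν₀ α X m ω) (X m ω))
    (abs_le.2 ⟨hB2.1.trans hν₀.1, hν₀.2.trans hB3.2⟩) (fun m => rfl) ha (fun m => hA ⟨m, rfl⟩)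
    (fun m => abs_estimator_le R γ Rl Ru N K n _ _)
    (fun m h => estimator_nonneg R hγ₀ hγ₁ hRlu hN hK hn (hcons m) (hB1.2.trans h) (hB3.2.trans h))
    (fun m h => estimator_nonpos R hγ₀ hγ₁ hRlu hN hK hn (hcons m) (h.trans hB1.1) (h.trans hB2.1))
  obtain ⟨c, d, hcd, hzero, hlim⟩ := exists_Icc_tendsto_infDist hbdd fun p hp =>
    eventually_away_of_ne_zero hL.continuous.continuousAt
      (abs_meanEstimator_le (R := R) γ Rl Ru N K n P s)
      (fun m => by simp only [iterate, D]; ring) ha hsum' ha0 hξ hp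
  exact ⟨Set.Icc c d, isCompact_Icc, isConnected_Icc hcd,
    isInternallyChainTransitiveInvariant_Icc hL.neg fun p hp => by simp [hzero p hp], hlim⟩
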